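/- **Theorem.** Let $n\ge 2$, let $A\in\mathbb R^{n\times d}$ have nonzero rows $A_1,\dots,A_n$, let $g:\mathbb R^d\to(-\infty,+\infty]$ and $h_i^*:\mathbb R\to(-\infty,+\infty]$ ($1\le i\le n$) be proper, convex and lower semicontinuous, put $h^*(y)=\sum_{i=1}^n h_i^*(y^{(i)})$ and $$L(x,y)=\langle Ax,y\rangle-h^*(y)+g(x),$$ and assume that $L$ has a saddle point. Let $\gamma\in(0,1)$, $x_0\in\operatorname{dom}g$, $y_0\in\operatorname{dom}h^*$, $M=\max_i\|A_i\|$ (Euclidean norms), $\tau=\frac1{nM}$, $\sigma^{(i)}=\frac{\gamma}{\|A_i\|}$, $\underline\sigma=\frac{\gamma}{nM}$, and $\lambda_0=1$, $\lambda_1=\frac1{n-1}$, $\lambda_{k+1}=\min\bigl(1,\frac n{n-1}\lambda_k\bigr)$ for $k\ge1$. With $\operatorname{prox}_{t,f}(v)=\operatorname{argmin}_u\, f(u)+\frac1{2t}\|u-v\|^2$, dense PURE-CD with deterministic initialization is $$\bar x_1=x_1=\operatorname{prox}_{\tau,g}(x_0-\tau A^\top y_0),\qquad y_1=\operatorname{prox}_{\underline\sigma,h^*}(y_0+\underline\sigma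 Ax_1),$$ and, for $k\ge1$, with independent indices $i_k$ that are uniformly distributed on $\{1,\dots,n\}$, $$\bar x_{k+1}=\operatorname{prox}_{\tau\lambda_k,g}(x_k-\tau\lambda_kA^\top y_k),\qquad y_{k+1}^{(i_k)}=\operatorname{prox}_{\lambda_k\sigma^{(i_k)},h^*_{i_k}}\bigl(y_k^{(i_k)}+\lambda_k\sigma^{(i_k)}A_{i_k}\bar x_{k+1}\bigr),$$ $$y_{k+1}^{(i)}=y_k^{(i)}\ (i\ne i_k),\qquad x_{k+1}=\bar x_{k+1}-\tau\lambda_k n A^\top(y_{k+1}-y_k).$$ For $K\ge2$ put $\Lambda_K=\sum_{k=0}^{K-1}\lambda_k$, $$x^K=\frac1{\Lambda_K}\sum_{k=0}^{K-1}\lambda_k\bar x_{k+1},\qquad y^K=\frac{1}{\Lambda_K}\Bigl(n\lambda_{K-1}y_K+\sum_{k=1}^{K-2}\bigl(n\lambda_k-(n-1)\lambda_{k+1}\bigr)y_{k+1}\Bigr).$$ Let $\mathcal Z\subset\mathbb R^d\times\mathbb R^n$ be nonempty and compact, $D_{\mathcal Z}=\max_{(x,y)\in\mathcal Z}\bigl(\|x-x_0\|^2+\|y-y_0\|^2\bigr)$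 and $\operatorname{Gap}(x',y')=\max_{(x,y)\in\mathcal Z}\,[L(x',y)-L(x,y')]$. 1. Whenever $(n-1)\log(n-1)\le K_0\le 1+n\log(n-1)$ and $K\ge2$, $$\mathbb E\operatorname{Gap}(x^K,y^K)\le\begin{cases}\bigl(1+\frac1{n-1}\bigr)^{-K}\,\dfrac{6nMD_{\mathcal Z}}{\gamma(1-\gamma)},&K\le K_0,\\[2ex]\dfrac{6nMD_{\mathcal Z}}{\bigl(K-K_0-1+\frac{(n-1)^2}{n}\bigr)\gamma(1-\gamma)},&K>K_0.\end{cases}$$ 2. There is a constant $C$ that depends only on $\gamma$ such that, for every $\varepsilon>0$, with $$R=n+n\min\Bigl\{\log n,\ \log\Bigl(1+\frac{nMD_{\mathcal Z}}{\varepsilon}\Bigr)\Bigr\}+\frac{nMD_{\mathcal Z}}{\varepsilon},$$ there is $K_1\le C\,R$ with $\mathbb E\operatorname{Gap}(x^K,y^K)\le\varepsilon$ for all $K\ge K_1$, and $(x^{K_1},y^{K_1})$ is computed with at most $C\,R\,d$ operations, hence with at most $$C\,(1+\log n)\Bigl(nd+\frac{nd\,M\,D_{\mathcal Z}}{\varepsilon}\Bigr)=\tilde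 O\Bigl(nd+\frac{nd\,M\,D_{\mathcal Z}}{\varepsilon}\Bigr)$$ operations. Here an arithmetic operation, comparison, square root, random draw or writing of a vector entry costs one operation, and a proximal operator of a function of $m$ real variables costs $m$ operations. -/

import Mathlib

open MeasureTheory ProbabilityTheory
open scoped ENNReal

noncomputable section

namespace PureCD

/-! ### Convex-concave saddle point problems -/

/-- Proper, convex (epigraph is a convex set) and lower semicontinuous functions with values in
`(-∞, +∞]`. -/
structure IsProperConvexLsc {E : Type*} [AddCommGroup E] [Module ℝ E] [TopologicalSpace E]
    (f : E → EReal) : Prop where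
  ne_bot : ∀ x, f x ≠ ⊥
  proper : ∃ x, f x ≠ ⊤
  convex : Convex ℝ {p : E × ℝ | f p.1 ≤ (p.2 : EReal)}
  lsc : LowerSemicontinuous f

/-- The data of the problem
`min_x max_y L(x, y)`, `L(x, y) = ⟨A x, y⟩ - ∑ i, hᵢ*(yᵢ) + g(x)`. -/
structure Problem (n d : ℕ) where
  /-- the matrix whose rows are `A₁, …, Aₙ` -/
  A : Matrix (Fin n) (Fin d) ℝ
  /-- the primal function `g` -/
  g : EuclideanSpace ℝ (Fin d) → EReal
  /-- the functions `hᵢ*` (the star is part of the name) -/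
  h : Fin n → ℝ → EReal

variable {n d : ℕ}

namespace Problem

/-- `x ↦ A x`. -/
def mulA (P : Problem n d) (x : EuclideanSpace ℝ (Fin d)) : EuclideanSpace ℝ (Fin n) :=
  WithLp.toLp 2 (P.A.mulVec x.ofLp)

/-- `y ↦ Aᵀ y`. -/
def mulAT (P : Problem n d) (y : EuclideanSpace ℝ (Fin n)) : EuclideanSpace ℝ (Fin d) :=
  WithLp.toLp 2 (P.A.transpose.mulVec y.ofLp)

/-- The separable function `h*(y) = ∑ i, hᵢ*(yᵢ)`. -/
def hstar (P : Problem n d) (y : EuclideanSpace ℝ (Fin n)) : EReal := ∑ i, P.h i (y i)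

/-- `L(x, y) = ⟨A x, y⟩ - h*(y) + g(x)`. -/
def L (P : Problem n d) (x : EuclideanSpace ℝ (Fin d)) (y : EuclideanSpace ℝ (Fin n)) : EReal :=
  ((inner ℝ (P.mulA x) y : ℝ) : EReal) - P.hstar y + P.g x

/-- `(xs, ys)` is a saddle point: `L(x, ys) ≥ L(xs, ys) ≥ L(xs, y)` for all `x`, `y`. -/
def IsSaddle (P : Problem n d) (xs : EuclideanSpace ℝ (Fin d)) (ys : EuclideanSpace ℝ (Fin n)) :
    Prop :=
  ∀ x y, P.L xs ys ≤ P.L x ys ∧ P.L xs y ≤ P.L xs ys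

/-- The standing assumption: `g` and `h*` are proper, convex and lower semicontinuous, and a saddle
point exists. Since `h*(y) = ∑ i, hᵢ*(yᵢ)`, the condition on `h*` holds exactly when every `hᵢ*` is
proper, convex and lower semicontinuous. -/
structure Standing (P : Problem n d) : Prop where
  g_pcl : IsProperConvexLsc P.g
  h_pcl : ∀ i, IsProperConvexLsc (P.h i)
  saddle : ∃ xs ys, P.IsSaddle xs ys

/-- The Euclidean norm of the `i`-th row of `A`. -/
def rowNorm (P : Problem n d) (i : Fin n) : ℝ :=
  ‖(WithLp.toLp 2 (P.A i) : EuclideanSpace ℝ (Fin d))‖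

/-- `max_i ‖A_i‖`. -/
def maxRowNorm (P : Problem n d) : ℝ := ⨆ i, P.rowNorm i

/-- `G(x', y', x, y) = L(x', y) - L(x, y')`, with `z = (x, y)`. -/
def G (P : Problem n d) (x' : EuclideanSpace ℝ (Fin d)) (y' : EuclideanSpace ℝ (Fin n))
    (z : EuclideanSpace ℝ (Fin d) × EuclideanSpace ℝ (Fin n)) : EReal :=
  P.L x' z.2 - P.L z.1 y'

/-- The restricted duality gap `max_{(x, y) ∈ Z} G(x', y', x, y)`. -/
def gap (P : Problem n d) (Z : Set (EuclideanSpace ℝ (Fin d) × EuclideanSpace ℝ (Fin n)))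
    (x' : EuclideanSpace ℝ (Fin d)) (y' : EuclideanSpace ℝ (Fin n)) : EReal :=
  ⨆ z ∈ Z, P.G x' y' z

end Problem

/-- `D_Z = max_{(x, y) ∈ Z} (‖x - x₀‖² + ‖y - y₀‖²)`. -/
def DZ (x0 : EuclideanSpace ℝ (Fin d)) (y0 : EuclideanSpace ℝ (Fin n))
    (Z : Set (EuclideanSpace ℝ (Fin d) × EuclideanSpace ℝ (Fin n))) : ℝ :=
  sSup ((fun z => ‖z.1 - x0‖ ^ 2 + ‖z.2 - y0‖ ^ 2) '' Z)

/-- Expectation of an extended-real random variable, `E[f⁺] - E[f⁻]`. -/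
def expectation {Ω : Type*} [MeasurableSpace Ω] (μ : Measure Ω) (f : Ω → EReal) : EReal :=
  ((∫⁻ ω, (f ω).toENNReal ∂μ : ℝ≥0∞) : EReal) - ((∫⁻ ω, (-f ω).toENNReal ∂μ : ℝ≥0∞) : EReal)

/-! ### The algorithm -/

/-- `prox_{τ, f}(x) = argmin_u f(u) + (1 / (2 τ)) ‖u - x‖²`. For `τ > 0` and `f` proper, convex and
lower semicontinuous on a Euclidean space, the minimizer exists and is unique. -/
def prox {E : Type*} [NormedAddCommGroup E] (τ : ℝ) (f : E → EReal) (x : E) : E :=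
  Classical.epsilon fun u => ∀ v,
    f u + ((1 / (2 * τ) * ‖u - x‖ ^ 2 : ℝ) : EReal)
      ≤ f v + ((1 / (2 * τ) * ‖v - x‖ ^ 2 : ℝ) : EReal)

/-- The iterates `x̄_k`, `x_k`, `y_k` of one iteration. -/
structure Iterate (n d : ℕ) where
  xbar : EuclideanSpace ℝ (Fin d)
  x : EuclideanSpace ℝ (Fin d)
  y : EuclideanSpace ℝ (Fin n)

/-- One iteration of dense PURE-CD with `T_k = τ I`, `Σ_k = diag(σ)`, `Θ_k = I`, `P = diag(p)`, when
the coordinate `i` has been picked. -/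
def step (P : Problem n d) (τ : ℝ) (σ p : Fin n → ℝ) (i : Fin n) (s : Iterate n d) :
    Iterate n d :=
  let xbar := prox τ P.g (s.x - τ • P.mulAT s.y)
  let y : EuclideanSpace ℝ (Fin n) := WithLp.toLp 2 (Function.update s.y.ofLp i
    (prox (σ i) (P.h i) (s.y i + σ i * P.mulA xbar i)))
  let x := xbar - τ • P.mulAT (WithLp.toLp 2 fun j => (p j)⁻¹ * (y j - s.y j))
  ⟨xbar, x, y⟩

/-- The deterministic first iteration: `x̄₁ = x₁ = prox_{τ, g}(x₀ - τ Aᵀ y₀)` and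
`y₁ = prox_{σ, h*}(y₀ + σ A x₁)`. -/
def initStep (P : Problem n d) (τ σ : ℝ) (x0 : EuclideanSpace ℝ (Fin d))
    (y0 : EuclideanSpace ℝ (Fin n)) : Iterate n d :=
  let x1 := prox τ P.g (x0 - τ • P.mulAT y0)
  ⟨x1, x1, prox σ P.hstar (y0 + σ • P.mulA x1)⟩

/-- The weights: `λ₀ = 1`, `λ₁ = 1 / (n - 1)`, `λ_{k+1} = min(1, n / (n - 1) λ_k)`. -/
def lam (n : ℕ) : ℕ → ℝ
  | 0 => 1
  | 1 => 1 / ((n : ℝ) - 1)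
  | k + 2 => min 1 ((n : ℝ) / ((n : ℝ) - 1) * lam n (k + 1))

/-- `Λ_K = ∑_{k=0}^{K-1} λ_k`. -/
def Lam (n K : ℕ) : ℝ := ∑ k ∈ Finset.range K, lam n k

/-- `τ = 1 / (n max_i ‖A_i‖)`. -/
def tau (P : Problem n d) : ℝ := 1 / ((n : ℝ) * P.maxRowNorm)

/-- `σ⁽ⁱ⁾ = γ / ‖A_i‖`. -/
def sigma (P : Problem n d) (γ : ℝ) (i : Fin n) : ℝ := γ / P.rowNorm i

/-- The dual step size `γ / (n max_i ‖A_i‖) = (min_i σ⁽ⁱ⁾) / n` of the first iteration. -/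
def sigmaInit (P : Problem n d) (γ : ℝ) : ℝ := γ / ((n : ℝ) * P.maxRowNorm)

/-- The iterates with the deterministic first iteration; `ι k` is the coordinate picked in iteration
`k` (for `k ≥ 1`). The entry with index `k` holds `x̄_k`, `x_k`, `y_k`; there is no `x̄₀`, and the
value stored for it is never used. -/
def iterates (P : Problem n d) (γ : ℝ) (x0 : EuclideanSpace ℝ (Fin d))
    (y0 : EuclideanSpace ℝ (Fin n)) (ι : ℕ → Fin n) : ℕ → Iterate n d
  | 0 => ⟨x0, x0, y0⟩
  | 1 => initStep P (tau P) (sigmaInit P γ) x0 y0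
  | k + 2 => step P (tau P * lam n (k + 1)) (fun i => lam n (k + 1) * sigma P γ i)
      (fun _ => 1 / (n : ℝ)) (ι (k + 1)) (iterates P γ x0 y0 ι (k + 1))

/-- `x^K = (1 / Λ_K) ∑_{k=0}^{K-1} λ_k x̄_{k+1}`. -/
def xAvg (P : Problem n d) (γ : ℝ) (x0 : EuclideanSpace ℝ (Fin d))
    (y0 : EuclideanSpace ℝ (Fin n)) (ι : ℕ → Fin n) (K : ℕ) : EuclideanSpace ℝ (Fin d) :=
  (1 / Lam n K) • ∑ k ∈ Finset.range K, lam n k • (iterates P γ x0 y0 ι (k + 1)).xbar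

/-- `y^K = (n λ_{K-1} y_K + ∑_{k=1}^{K-2} (n λ_k - (n - 1) λ_{k+1}) y_{k+1}) / Λ_K` (for `K ≥ 2`). -/
def yAvg (P : Problem n d) (γ : ℝ) (x0 : EuclideanSpace ℝ (Fin d))
    (y0 : EuclideanSpace ℝ (Fin n)) (ι : ℕ → Fin n) (K : ℕ) : EuclideanSpace ℝ (Fin n) :=
  (1 / Lam n K) • (((n : ℝ) * lam n (K - 1)) • (iterates P γ x0 y0 ι K).y
    + ∑ k ∈ Finset.Ico 1 (K - 1),
        ((n : ℝ) * lam n k - ((n : ℝ) - 1) * lam n (k + 1)) • (iterates P γ x0 y0 ι (k + 1)).y)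

/-! ### Operation counts

A computation over the reals that counts its operations: arithmetic operations, comparisons, square
roots, drawing a random index and writing one entry of a vector cost one operation each, and the
evaluation of a proximal operator of a function of `m` real variables costs `m` operations. -/

/-- A value together with the number of operations spent on it. -/
structure Counted (α : Type) where
  value : α
  ops : ℕ

namespace Counted

instance : Monad Counted where
  pure a := ⟨a, 0⟩
  bind c f := ⟨(f c.value).value, c.ops + (f c.value).ops⟩

def add (a b : ℝ) : Counted ℝ := ⟨a + b, 1⟩
def sub (a b : ℝ) : Counted ℝ := ⟨a - b, 1⟩
def mul (a b : ℝ) : Counted ℝ := ⟨a * b, 1⟩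
def div (a b : ℝ) : Counted ℝ := ⟨a / b, 1⟩
def sqrt (a : ℝ) : Counted ℝ := ⟨Real.sqrt a, 1⟩
def min (a b : ℝ) : Counted ℝ := ⟨Min.min a b, 1⟩

/-- Run `f` on every index and add up the results. -/
def sum {m : ℕ} (f : Fin m → Counted ℝ) : Counted ℝ :=
  ⟨∑ j, (f j).value, ∑ j, ((f j).ops + 1)⟩

/-- Run `f` on every index and take the largest result. -/
def max {m : ℕ} (f : Fin m → Counted ℝ) : Counted ℝ :=
  ⟨⨆ j, (f j).value, ∑ j, ((f j).ops + 1)⟩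

/-- Run `f` on every index and store the results in a vector. -/
def vector {m : ℕ} (f : Fin m → Counted ℝ) : Counted (EuclideanSpace ℝ (Fin m)) :=
  ⟨WithLp.toLp 2 fun j => (f j).value, ∑ j, ((f j).ops + 1)⟩

/-- Overwrite one entry of a vector. -/
def write {m : ℕ} (v : EuclideanSpace ℝ (Fin m)) (i : Fin m) (a : ℝ) :
    Counted (EuclideanSpace ℝ (Fin m)) :=
  ⟨WithLp.toLp 2 (Function.update v.ofLp i a), 1⟩

/-- Draw the random index of an iteration. -/
def draw (i : Fin n) : Counted (Fin n) := ⟨i, 1⟩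

/-- Proximal operator of a function of one variable. -/
def prox₁ (τ : ℝ) (f : ℝ → EReal) (a : ℝ) : Counted ℝ := ⟨prox τ f a, 1⟩

/-- Proximal operator of a function of `m` variables. -/
def proxVec {m : ℕ} (τ : ℝ) (f : EuclideanSpace ℝ (Fin m) → EReal)
    (v : EuclideanSpace ℝ (Fin m)) : Counted (EuclideanSpace ℝ (Fin m)) := ⟨prox τ f v, m⟩

end Counted

/-- The memory of the implementation before iteration `k ≥ 1`: the step sizes, `x_k`, `y_k`,
`v = Aᵀ y_k`, `sx = ∑_{j<k} λ_j x̄_{j+1}`, `λ_k`, `Λ_k`, and a vector `u` such that the weighted sum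
of the dual iterates equals `Λ_k y_k + u` (this way one iteration changes only one entry of `u`). -/
structure Memory (n d : ℕ) where
  τ : ℝ
  σ : EuclideanSpace ℝ (Fin n)
  x : EuclideanSpace ℝ (Fin d)
  y : EuclideanSpace ℝ (Fin n)
  v : EuclideanSpace ℝ (Fin d)
  sx : EuclideanSpace ℝ (Fin d)
  u : EuclideanSpace ℝ (Fin n)
  lam : ℝ
  Lam : ℝ

open Counted in
/-- Computation of the step sizes and the first iteration. -/
def runInit (P : Problem n d) (γ : ℝ) (x0 : EuclideanSpace ℝ (Fin d))
    (y0 : EuclideanSpace ℝ (Fin n)) : Counted (Memory n d) := do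
  let norms ← vector fun i => do
    let s ← sum fun j => mul (P.A i j) (P.A i j)
    sqrt s
  let big ← Counted.max fun i => pure (norms i)
  let nbig ← mul n big
  let τ ← div 1 nbig
  let σ₀ ← div γ nbig
  let σ ← vector fun i => div γ (norms i)
  let v₀ ← vector fun j => sum fun i => mul (P.A i j) (y0 i)
  let a ← vector fun j => do
    let t ← mul τ (v₀ j)
    sub (x0 j) t
  let x₁ ← proxVec τ P.g a
  let b ← vector fun i => do
    let s ← sum fun j => mul (P.A i j) (x₁ j)
    let t ← mul σ₀ s
    add (y0 i) t
  let y₁ ← proxVec σ₀ P.hstar b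
  let v₁ ← vector fun j => sum fun i => mul (P.A i j) (y₁ i)
  let u ← vector fun _ => pure 0
  let n₁ ← sub n 1
  let l₁ ← div 1 n₁
  pure ⟨τ, σ, x₁, y₁, v₁, x₁, u, l₁, 1⟩

open Counted in
/-- One iteration `k ≥ 1`, in which the random index takes the value `ik`. -/
def runStep (P : Problem n d) (ik : Fin n) (m : Memory n d) : Counted (Memory n d) := do
  let τk ← mul m.τ m.lam
  let a ← vector fun j => do
    let t ← mul τk (m.v j)
    sub (m.x j) t
  let xbar ← proxVec τk P.g a
  let i ← draw ik
  let σk ← mul m.lam (m.σ i)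
  let s ← sum fun j => mul (P.A i j) (xbar j)
  let t ← mul σk s
  let w ← add (m.y i) t
  let yi ← prox₁ σk (P.h i) w
  let δ ← sub yi (m.y i)
  let y ← write m.y i yi
  let nδ ← mul n δ
  let c ← mul τk nδ
  let x ← vector fun j => do
    let t ← mul c (P.A i j)
    sub (xbar j) t
  let v ← vector fun j => do
    let t ← mul δ (P.A i j)
    add (m.v j) t
  let sx ← vector fun j => do
    let t ← mul m.lam (xbar j)
    add (m.sx j) t
  let Lam' ← add m.Lam m.lam
  let nl ← mul n m.lam
  let e ← sub nl Lam'
  let eδ ← mul e δ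
  let ui ← add (m.u i) eδ
  let u ← write m.u i ui
  let n₁ ← sub n 1
  let r ← div n n₁
  let rl ← mul r m.lam
  let lam' ← Counted.min 1 rl
  pure ⟨m.τ, m.σ, x, y, v, sx, u, lam', Lam'⟩

/-- `runLoop j` performs the first iteration and the iterations `1, …, j`. -/
def runLoop (P : Problem n d) (γ : ℝ) (x0 : EuclideanSpace ℝ (Fin d))
    (y0 : EuclideanSpace ℝ (Fin n)) (ι : ℕ → Fin n) : ℕ → Counted (Memory n d)
  | 0 => runInit P γ x0 y0
  | j + 1 => do
    let m ← runLoop P γ x0 y0 ι j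
    runStep P (ι (j + 1)) m

open Counted in
/-- The whole algorithm with `K` iterations (numbered `0, …, K - 1`) and the output of the averages
`x^K` and `y^K`. -/
def run (P : Problem n d) (γ : ℝ) (x0 : EuclideanSpace ℝ (Fin d))
    (y0 : EuclideanSpace ℝ (Fin n)) (ι : ℕ → Fin n) (K : ℕ) :
    Counted (EuclideanSpace ℝ (Fin d) × EuclideanSpace ℝ (Fin n)) := do
  let m ← runLoop P γ x0 y0 ι (K - 1)
  let xK ← vector fun j => div (m.sx j) m.Lam
  let yK ← vector fun i => do
    let t ← div (m.u i) m.Lam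
    add (m.y i) t
  pure (xK, yK)

end PureCD

end

noncomputable section

namespace PureCD

variable {n d : ℕ}

/-! ### Sums of extended reals -/

/-! An iteration is analysed as if the whole dual vector were updated. Write ŷ for the vector of all
scalar dual proximal points. For separable `F`, the average of `n F(y_{k+1}) - (n-1) F(y_k)` over
the picked coordinate is `F(ŷ)`. The optimality inequalities of the primal prox and of all `n` dual
proxes therefore add up to a full primal-dual step plus an error with mean zero. The correction of
`x` by `n τ λ Aᵀ(y_{k+1} - y_k)` supplies the bilinear coupling, at the price of an error quadratic
in the dual increment. Multiplying by `λ_k` removes `λ_k` from the proximal terms, so the squared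
distances telescope with constant coefficients (`step_le`, `path_le`).

The maximum over the comparison point stands inside the expectation, so the mean-zero error cannot
simply be discarded. Its dependence on `y` is linear: it is `⟨y - y0, S⟩` with an accumulated noise
vector `S`, plus a part independent of `y`. Young's inequality (`sum_mul_noise_le`) bounds the
pairing by a multiple of `‖y - y0‖²` plus a weighted square of `S`. Each iteration leaves a negative
term `-(1/2) ∑ w_j (ŷ_j - y_j)²` with `w_j = ‖A_j‖/γ`. Its fraction `γ` pays for the primal
correction and its fraction `1 - γ` for the growth of the mean square of `S`. Hence `pathPotential`
starts at zero and its expectation never increases (`sum_potential_le`,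
`integral_pathPotential_nonpos`).

Summation by parts turns the dual terms into a combination of the values at `y_2, …, y_K`
(`dual_summation_by_parts`). The term at `y_1` vanishes because `(n-1) λ_1 = 1`, and the other
coefficients are nonnegative because `(n-1) λ_{k+1} ≤ n λ_k`. Jensen's inequality then gives the
expected gap bound `n M D / (γ (1-γ) Λ_K)` (`expectation_gap_le`).

It remains to estimate `Λ_K`. With `q = n/(n-1)`, it equals `q^(K-1)` until the weights reach one,
after about `n log n` iterations, and then grows by one per iteration (`Lam_succ_cases`). This gives
both rates and the iteration count. The implementation costs `O(nd)` at the start and `O(d)` per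
iteration; an invariant of its memory (`Memory.Valid`) shows that it returns the averages. -/

theorem ereal_sum_ne_bot {ι : Type*} (s : Finset ι) (f : ι → EReal) (hf : ∀ i ∈ s, f i ≠ ⊥) :
    ∑ i ∈ s, f i ≠ ⊥ := by
  classical
  induction s using Finset.induction_on with
  | empty => simp
  | insert a s ha ih =>
    rw [Finset.sum_insert ha, EReal.add_ne_bot_iff]
    exact ⟨hf a (by simp), ih fun i hi => hf i (by simp [hi])⟩

theorem ereal_sum_ne_top_iff {ι : Type*} (s : Finset ι) (f : ι → EReal) (hf : ∀ i ∈ s, f i ≠ ⊥) :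
    ∑ i ∈ s, f i ≠ ⊤ ↔ ∀ i ∈ s, f i ≠ ⊤ := by
  classical
  induction s using Finset.induction_on with
  | empty => simp
  | insert a s ha ih =>
    have hs : ∀ i ∈ s, f i ≠ ⊥ := fun i hi => hf i (by simp [hi])
    rw [Finset.sum_insert ha, EReal.add_ne_top_iff_ne_top₂ (hf a (by simp))
      (ereal_sum_ne_bot s f hs), ih hs]
    simp

theorem ereal_sum_eq_coe {ι : Type*} (s : Finset ι) (f : ι → EReal)
    (hf : ∀ i ∈ s, f i ≠ ⊥) (hf' : ∀ i ∈ s, f i ≠ ⊤) :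
    ∑ i ∈ s, f i = ((∑ i ∈ s, (f i).toReal : ℝ) : EReal) := by
  classical
  induction s using Finset.induction_on with
  | empty => simp
  | insert a s ha ih =>
    rw [Finset.sum_insert ha, Finset.sum_insert ha, EReal.coe_add,
      ih (fun i hi => hf i (by simp [hi])) (fun i hi => hf' i (by simp [hi])),
      EReal.coe_toReal (hf' a (by simp)) (hf a (by simp))]

theorem lowerSemicontinuous_ereal_add {E : Type*} [TopologicalSpace E] {f g : E → EReal}
    (hf : LowerSemicontinuous f) (hg : LowerSemicontinuous g) (hfb : ∀ x, f x ≠ ⊥)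
    (hgb : ∀ x, g x ≠ ⊥) : LowerSemicontinuous fun x => f x + g x :=
  hf.add' hg fun x => EReal.continuousAt_add (.inr (hgb x)) (.inl (hfb x))

theorem lowerSemicontinuous_ereal_sum {E ι : Type*} [TopologicalSpace E] (s : Finset ι)
    (f : ι → E → EReal) (hf : ∀ i ∈ s, LowerSemicontinuous (f i)) (hb : ∀ i ∈ s, ∀ x, f i x ≠ ⊥) :
    LowerSemicontinuous fun x => ∑ i ∈ s, f i x := by
  classical
  induction s using Finset.induction_on with
  | empty => simpa using lowerSemicontinuous_const
  | insert a s ha ih =>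
    simp only [Finset.sum_insert ha]
    exact lowerSemicontinuous_ereal_add (hf a (by simp)) (ih (fun i hi => hf i (by simp [hi]))
      (fun i hi => hb i (by simp [hi]))) (hb a (by simp))
      fun x => ereal_sum_ne_bot _ _ fun i hi => hb i (by simp [hi]) x

/-! ### Convex functions with extended real values -/

section Convex

variable {E : Type*} [AddCommGroup E] [Module ℝ E] [TopologicalSpace E] {f : E → EReal}

theorem IsProperConvexLsc.coe_toReal (hf : IsProperConvexLsc f) {x : E} (hx : f x ≠ ⊤) :
    ((f x).toReal : EReal) = f x := EReal.coe_toReal hx (hf.ne_bot x)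

/-- On the effective domain the function is real valued, so Jensen's inequality and the convexity of
the domain become available without extended arithmetic. -/
theorem IsProperConvexLsc.convexOn_toReal (hf : IsProperConvexLsc f) :
    ConvexOn ℝ {x | f x ≠ ⊤} fun x => (f x).toReal := by
  have key : ∀ x, f x ≠ ⊤ → ∀ y, f y ≠ ⊤ → ∀ a b : ℝ, 0 ≤ a → 0 ≤ b → a + b = 1 →
      f (a • x + b • y) ≤ ((a * (f x).toReal + b * (f y).toReal : ℝ) : EReal) := by
    intro x hx y hy a b ha hb hab
    exact hf.convex (x := (x, (f x).toReal)) (by simp [hf.coe_toReal hx])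
      (y := (y, (f y).toReal)) (by simp [hf.coe_toReal hy]) ha hb hab
  refine ⟨fun x hx y hy a b ha hb hab => ?_, fun x hx y hy a b ha hb hab => ?_⟩
  · exact ne_top_of_le_ne_top (EReal.coe_ne_top _) (key x hx y hy a b ha hb hab)
  · have h := key x hx y hy a b ha hb hab
    exact (EReal.toReal_le_toReal h (hf.ne_bot _) (EReal.coe_ne_top _)).trans_eq
      (EReal.toReal_coe _)

theorem convex_epigraph_of_convexOn_toReal {E : Type*} [AddCommGroup E] [Module ℝ E]
    {f : E → EReal} (hb : ∀ x, f x ≠ ⊥)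
    (hf : ConvexOn ℝ {x | f x ≠ ⊤} fun x => (f x).toReal) :
    Convex ℝ {p : E × ℝ | f p.1 ≤ (p.2 : EReal)} := by
  intro p hp q hq a b ha hb' hab
  have hp' : f p.1 ≤ p.2 := hp
  have hq' : f q.1 ≤ q.2 := hq
  have hp1 : f p.1 ≠ ⊤ := ne_top_of_le_ne_top (EReal.coe_ne_top _) hp'
  have hq1 : f q.1 ≠ ⊤ := ne_top_of_le_ne_top (EReal.coe_ne_top _) hq'
  have hp2 : (f p.1).toReal ≤ p.2 := by
    simpa using EReal.toReal_le_toReal hp' (hb _) (EReal.coe_ne_top _)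
  have hq2 : (f q.1).toReal ≤ q.2 := by
    simpa using EReal.toReal_le_toReal hq' (hb _) (EReal.coe_ne_top _)
  have h1 := hf.2 hp1 hq1 ha hb' hab
  have h2 : f (a • p.1 + b • q.1) ≠ ⊤ := hf.1 hp1 hq1 ha hb' hab
  change f (a • p.1 + b • q.1) ≤ ((a • p.2 + b • q.2 : ℝ) : EReal)
  rw [← EReal.coe_toReal h2 (hb _), EReal.coe_le_coe_iff]
  refine h1.trans ?_
  simp only [smul_eq_mul]
  gcongr

end Convex

/-! ### Proximal operators -/

section Prox

variable {E : Type*} [NormedAddCommGroup E] [InnerProductSpace ℝ E]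

/-- An affine minorant makes the regularized function coercive, so a minimizer over a large closed
ball is a global one. -/
theorem exists_prox_minimizer [FiniteDimensional ℝ E] {f : E → EReal} (hf : IsProperConvexLsc f)
    {a : E} {b : ℝ} (hab : ∀ u, ((inner ℝ a u + b : ℝ) : EReal) ≤ f u) {c : ℝ} (hc : 0 < c) (v : E) :
    ∃ u, ∀ w, f u + ((c * ‖u - v‖ ^ 2 : ℝ) : EReal) ≤ f w + ((c * ‖w - v‖ ^ 2 : ℝ) : EReal) := by
  obtain ⟨w0, hw0⟩ := hf.proper
  set F : E → EReal := fun u => f u + ((c * ‖u - v‖ ^ 2 : ℝ) : EReal) with hF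
  have hlsc : LowerSemicontinuous F :=
    lowerSemicontinuous_ereal_add hf.lsc
      (Continuous.lowerSemicontinuous (continuous_coe_real_ereal.comp (by fun_prop)))
      hf.ne_bot fun x => EReal.coe_ne_bot _
  set m0 : ℝ := (f w0).toReal + c * ‖w0 - v‖ ^ 2
  have hFw0 : F w0 = (m0 : EReal) := by
    simp only [hF, m0, EReal.coe_add, hf.coe_toReal hw0]
  set B : ℝ := max (m0 - inner ℝ a v - b) 0
  have hB0 : 0 ≤ B := le_max_right _ _
  have hB1 : m0 - inner ℝ a v - b ≤ B := le_max_left _ _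
  -- For `r ≥ R` one has `c r² ≥ (‖a‖ + B) r ≥ ‖a‖ r + B`. This beats the linear decrease of the
  -- minorant and keeps the value outside the ball above the value at `w0`.
  set R : ℝ := max ‖w0 - v‖ (max 1 ((‖a‖ + B) / c))
  obtain ⟨u, hu, hmin⟩ := LowerSemicontinuousOn.exists_isMinOn (s := Metric.closedBall v R)
    ⟨w0, by simp [R, dist_eq_norm]⟩ (isCompact_closedBall v R) (hlsc.lowerSemicontinuousOn _)
  have hu0 : F u ≤ m0 := hFw0 ▸ hmin (by simp [R, dist_eq_norm])
  refine ⟨u, fun w => ?_⟩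
  by_cases hw : w ∈ Metric.closedBall v R
  · exact hmin hw
  · refine hu0.trans ?_
    have hr : R < ‖w - v‖ := by simpa [dist_eq_norm] using hw
    have hr1 : 1 ≤ ‖w - v‖ := ((le_max_left _ _).trans (le_max_right _ _)).trans hr.le
    have hr2 : (‖a‖ + B) / c ≤ ‖w - v‖ := ((le_max_right _ _).trans (le_max_right _ _)).trans hr.le
    rw [div_le_iff₀ hc] at hr2
    have h1 : m0 ≤ inner ℝ a w + b + c * ‖w - v‖ ^ 2 := by
      have h2 : inner ℝ a w = inner ℝ a v + inner ℝ a (w - v) := by rw [inner_sub_right]; ring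
      have h3 : -(‖a‖ * ‖w - v‖) ≤ inner ℝ a (w - v) :=
        (abs_le.1 (abs_real_inner_le_norm a (w - v))).1
      nlinarith [mul_le_mul_of_nonneg_right hr2 (norm_nonneg (w - v)),
        mul_le_mul_of_nonneg_left hr1 hB0]
    calc (m0 : EReal) ≤ ((inner ℝ a w + b + c * ‖w - v‖ ^ 2 : ℝ) : EReal) := by exact_mod_cast h1
      _ = ((inner ℝ a w + b : ℝ) : EReal) + ((c * ‖w - v‖ ^ 2 : ℝ) : EReal) := by
        rw [← EReal.coe_add]
      _ ≤ _ := by gcongr; exact hab w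

/-- The optimality condition of the proximal operator. -/
theorem prox_spec [FiniteDimensional ℝ E] {f : E → EReal} (hf : IsProperConvexLsc f)
    {a : E} {b : ℝ} (hab : ∀ u, ((inner ℝ a u + b : ℝ) : EReal) ≤ f u) {t : ℝ} (ht : 0 < t) (v : E) :
    f (prox t f v) ≠ ⊤ ∧ ∀ w, f w ≠ ⊤ →
      (f (prox t f v)).toReal - (f w).toReal ≤ 1 / t * inner ℝ (prox t f v - v) (w - prox t f v) := by
  have hc : 0 < 1 / (2 * t) := by positivity
  set c := 1 / (2 * t) with hcdef
  set p := prox t f v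
  have hp : ∀ w, f p + ((c * ‖p - v‖ ^ 2 : ℝ) : EReal) ≤ f w + ((c * ‖w - v‖ ^ 2 : ℝ) : EReal) :=
    Classical.epsilon_spec (exists_prox_minimizer hf hab hc v)
  have hpt : f p ≠ ⊤ := by
    obtain ⟨w0, hw0⟩ := hf.proper
    intro h
    have h1 := hp w0
    rw [h, EReal.top_add_coe, ← hf.coe_toReal hw0, ← EReal.coe_add] at h1
    exact EReal.coe_ne_top _ (top_le_iff.1 h1)
  have hpr : ∀ w, f w ≠ ⊤ → (f p).toReal + c * ‖p - v‖ ^ 2 ≤ (f w).toReal + c * ‖w - v‖ ^ 2 := by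
    intro w hw
    have h1 := hp w
    rw [← hf.coe_toReal hw, ← hf.coe_toReal hpt] at h1
    exact_mod_cast h1
  refine ⟨hpt, fun w hw => ?_⟩
  -- Compare `p` with `p + s (w - p)`, use convexity and divide by `s`; the remainder of order `s`
  -- disappears as `s → 0`.
  have hs : ∀ s ∈ Set.Ioo (0 : ℝ) 1, (f p).toReal - (f w).toReal ≤
      1 / t * inner ℝ (p - v) (w - p) + s * (c * ‖w - p‖ ^ 2) := by
    intro s hs
    have hconv := hf.convexOn_toReal
    have hmem := hconv.1 hpt hw (sub_nonneg.2 hs.2.le) hs.1.le (by ring)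
    have h1 := hconv.2 hpt hw (sub_nonneg.2 hs.2.le) hs.1.le (by ring)
    have h2 := hpr _ hmem
    have h3 : (1 - s) • p + s • w - v = (p - v) + s • (w - p) := by module
    rw [h3, norm_add_sq_real, norm_smul, inner_smul_right, mul_pow, Real.norm_eq_abs, sq_abs] at h2
    simp only [smul_eq_mul] at h1
    have h4 : s * ((f p).toReal - (f w).toReal) ≤
        s * (1 / t * inner ℝ (p - v) (w - p) + s * (c * ‖w - p‖ ^ 2)) := by
      have h5 : 1 / t = 2 * c := by rw [hcdef]; field_simp
      rw [h5]
      nlinarith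
    exact le_of_mul_le_mul_left h4 hs.1
  have hlim : Filter.Tendsto (fun s : ℝ => 1 / t * inner ℝ (p - v) (w - p) + s * (c * ‖w - p‖ ^ 2))
      (nhdsWithin 0 (Set.Ioi 0)) (nhds (1 / t * inner ℝ (p - v) (w - p) + 0 * (c * ‖w - p‖ ^ 2))) :=
    ((continuous_const.add (continuous_id.mul continuous_const)).tendsto 0).mono_left
      nhdsWithin_le_nhds
  have := ge_of_tendsto hlim (Filter.eventually_of_mem (Ioo_mem_nhdsGT one_pos) hs)
  simpa using this

end Prox

/-! ### The saddle point problem -/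

namespace Problem

/-- The `i`-th row of `A`. -/
def row (P : Problem n d) (i : Fin n) : EuclideanSpace ℝ (Fin d) := WithLp.toLp 2 (P.A i)

theorem mulA_apply (P : Problem n d) (x : EuclideanSpace ℝ (Fin d)) (i : Fin n) :
    P.mulA x i = inner ℝ (P.row i) x := by
  simp [mulA, row, Matrix.mulVec, dotProduct, PiLp.inner_apply, mul_comm]

theorem mulA_add (P : Problem n d) (x x' : EuclideanSpace ℝ (Fin d)) :
    P.mulA (x + x') = P.mulA x + P.mulA x' := by
  ext i; simp [mulA_apply, inner_add_right]

theorem mulA_sub (P : Problem n d) (x x' : EuclideanSpace ℝ (Fin d)) :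
    P.mulA (x - x') = P.mulA x - P.mulA x' := by
  ext i; simp [mulA_apply, inner_sub_right]

theorem mulA_smul (P : Problem n d) (c : ℝ) (x : EuclideanSpace ℝ (Fin d)) :
    P.mulA (c • x) = c • P.mulA x := by
  ext i; simp [mulA_apply, inner_smul_right]

theorem mulAT_eq_sum (P : Problem n d) (y : EuclideanSpace ℝ (Fin n)) :
    P.mulAT y = ∑ i, y i • P.row i := by
  ext j; simp [mulAT, row, Matrix.mulVec, dotProduct, mul_comm]

theorem inner_mulA (P : Problem n d) (x : EuclideanSpace ℝ (Fin d)) (y : EuclideanSpace ℝ (Fin n)) :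
    inner ℝ (P.mulA x) y = inner ℝ x (P.mulAT y) := by
  rw [mulAT_eq_sum, inner_sum, PiLp.inner_apply]
  refine Finset.sum_congr rfl fun i _ => ?_
  rw [mulA_apply, inner_smul_right, real_inner_comm x]
  simp

theorem inner_mulA_eq_sum (P : Problem n d) (x : EuclideanSpace ℝ (Fin d))
    (y : EuclideanSpace ℝ (Fin n)) : inner ℝ (P.mulA x) y = ∑ i, P.mulA x i * y i := by
  simp [PiLp.inner_apply, mul_comm]

theorem mulAT_add (P : Problem n d) (y y' : EuclideanSpace ℝ (Fin n)) :
    P.mulAT (y + y') = P.mulAT y + P.mulAT y' := by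
  simp [mulAT_eq_sum, add_smul, Finset.sum_add_distrib]

theorem mulAT_single (P : Problem n d) (i : Fin n) (a : ℝ) :
    P.mulAT (EuclideanSpace.single i a) = a • P.row i := by
  rw [mulAT_eq_sum, Finset.sum_eq_single i] <;> simp +contextual

/-- Young's inequality is applied to each row separately, so `‖x‖²` is charged `n` times and `‖y‖²`
only once. This is the asymmetry that `τ = 1/(nM)` is made for. -/
theorem inner_mulA_le (P : Problem n d) (x : EuclideanSpace ℝ (Fin d))
    (y : EuclideanSpace ℝ (Fin n)) :
    inner ℝ (P.mulA x) y ≤ n * P.maxRowNorm / 2 * ‖x‖ ^ 2 + P.maxRowNorm / 2 * ‖y‖ ^ 2 := by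
  have h : ∀ i, P.mulA x i * y i ≤ P.maxRowNorm / 2 * ‖x‖ ^ 2 + P.maxRowNorm / 2 * y i ^ 2 := by
    intro i
    have h1 : P.rowNorm i ≤ P.maxRowNorm := le_ciSup (Set.finite_range _).bddAbove i
    have h0 : 0 ≤ P.rowNorm i := norm_nonneg _
    have h2 : |P.mulA x i| ≤ P.maxRowNorm * ‖x‖ := by
      rw [mulA_apply]
      exact (abs_real_inner_le_norm _ _).trans (by gcongr; exact h1)
    have h3 : P.mulA x i * y i ≤ P.maxRowNorm * ‖x‖ * |y i| := by
      refine (le_abs_self _).trans ?_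
      rw [abs_mul]; gcongr
    nlinarith [sq_nonneg (‖x‖ - |y i|), sq_abs (y i), h0.trans h1,
      mul_nonneg (h0.trans h1) (sq_nonneg (‖x‖ - |y i|))]
  rw [inner_mulA_eq_sum, EuclideanSpace.real_norm_sq_eq y, Finset.mul_sum]
  refine (Finset.sum_le_sum fun i _ => h i).trans_eq ?_
  rw [Finset.sum_add_distrib, Finset.sum_const, Finset.card_univ, Fintype.card_fin, nsmul_eq_mul]
  ring

theorem maxRowNorm_pos (P : Problem n d) (hn : 2 ≤ n) (hA : ∀ i, P.A i ≠ 0) : 0 < P.maxRowNorm := by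
  have h1 : P.rowNorm ⟨0, by omega⟩ ≤ P.maxRowNorm := le_ciSup (Set.finite_range _).bddAbove _
  refine lt_of_lt_of_le ?_ h1
  simpa [rowNorm] using hA _

theorem rowNorm_pos (P : Problem n d) (hA : ∀ i, P.A i ≠ 0) (i : Fin n) : 0 < P.rowNorm i := by
  simpa [rowNorm] using hA _

theorem rowNorm_le (P : Problem n d) (i : Fin n) : P.rowNorm i ≤ P.maxRowNorm :=
  le_ciSup (Set.finite_range _).bddAbove i

namespace Standing

variable {P : Problem n d}

theorem hstar_ne_bot (hP : P.Standing) (y : EuclideanSpace ℝ (Fin n)) : P.hstar y ≠ ⊥ :=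
  ereal_sum_ne_bot _ _ fun i _ => (hP.h_pcl i).ne_bot _

theorem hstar_ne_top_iff (hP : P.Standing) (y : EuclideanSpace ℝ (Fin n)) :
    P.hstar y ≠ ⊤ ↔ ∀ i, P.h i (y i) ≠ ⊤ := by
  simpa [hstar] using ereal_sum_ne_top_iff Finset.univ (fun i => P.h i (y i))
    fun i _ => (hP.h_pcl i).ne_bot _

theorem hstar_toReal (hP : P.Standing) {y : EuclideanSpace ℝ (Fin n)} (hy : P.hstar y ≠ ⊤) :
    (P.hstar y).toReal = ∑ i, (P.h i (y i)).toReal := by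
  rw [hP.hstar_ne_top_iff] at hy
  rw [hstar, ereal_sum_eq_coe _ _ (fun i _ => (hP.h_pcl i).ne_bot _) fun i _ => hy i,
    EReal.toReal_coe]

theorem hstar_pcl (hP : P.Standing) : IsProperConvexLsc P.hstar where
  ne_bot := hP.hstar_ne_bot
  proper := by
    choose t ht using fun i => (hP.h_pcl i).proper
    exact ⟨WithLp.toLp 2 t, by simpa [hP.hstar_ne_top_iff] using ht⟩
  convex := by
    refine convex_epigraph_of_convexOn_toReal hP.hstar_ne_bot ?_
    have hdom : Convex ℝ {y | P.hstar y ≠ ⊤} := by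
      intro x hx y hy a b ha hb hab
      simp only [Set.mem_ofPred_eq, hP.hstar_ne_top_iff] at hx hy ⊢
      exact fun i => (hP.h_pcl i).convexOn_toReal.1 (hx i) (hy i) ha hb hab
    refine ⟨hdom, fun x hx y hy a b ha hb hab => ?_⟩
    have hxy := hdom hx hy ha hb hab
    simp only [Set.mem_ofPred_eq] at hx hy hxy
    simp only [hP.hstar_toReal hx, hP.hstar_toReal hy, hP.hstar_toReal hxy]
    rw [hP.hstar_ne_top_iff] at hx hy
    rw [Finset.smul_sum, Finset.smul_sum, ← Finset.sum_add_distrib]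
    exact Finset.sum_le_sum fun i _ => (hP.h_pcl i).convexOn_toReal.2 (hx i) (hy i) ha hb hab
  lsc := lowerSemicontinuous_ereal_sum _ _ (fun i _ =>
    (hP.h_pcl i).lsc.comp (by fun_prop)) fun i _ _ => (hP.h_pcl i).ne_bot _

theorem L_eq_coe (hP : P.Standing) {x : EuclideanSpace ℝ (Fin d)} {y : EuclideanSpace ℝ (Fin n)}
    (hx : P.g x ≠ ⊤) (hy : P.hstar y ≠ ⊤) :
    P.L x y = ((inner ℝ (P.mulA x) y - (P.hstar y).toReal + (P.g x).toReal : ℝ) : EReal) := by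
  rw [L, EReal.coe_add, EReal.coe_sub, EReal.coe_toReal hx (hP.g_pcl.ne_bot _),
    EReal.coe_toReal hy (hP.hstar_ne_bot _)]

theorem L_eq_bot {x : EuclideanSpace ℝ (Fin d)} {y : EuclideanSpace ℝ (Fin n)}
    (hy : P.hstar y = ⊤) : P.L x y = ⊥ := by
  simp [L, hy]

theorem L_eq_top (hP : P.Standing) {x : EuclideanSpace ℝ (Fin d)} {y : EuclideanSpace ℝ (Fin n)}
    (hx : P.g x = ⊤) (hy : P.hstar y ≠ ⊤) : P.L x y = ⊤ := by
  rw [L, hx, ← EReal.coe_toReal hy (hP.hstar_ne_bot _), ← EReal.coe_sub, EReal.coe_add_top]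

/-- If `h*(ys) = ⊤`, then `L xs ys = ⊥` whatever `g xs` is, which cannot dominate a value at a point
of the dual domain. Once `h*(ys)` is finite, `g xs = ⊤` fails in the same way. -/
theorem exists_finite_saddle (hP : P.Standing) :
    ∃ xs ys, P.IsSaddle xs ys ∧ P.g xs ≠ ⊤ ∧ P.hstar ys ≠ ⊤ := by
  obtain ⟨xs, ys, hs⟩ := hP.saddle
  obtain ⟨xd, hxd⟩ := hP.g_pcl.proper
  obtain ⟨yd, hyd⟩ := hP.hstar_pcl.proper
  have hy : P.hstar ys ≠ ⊤ := by
    intro h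
    have h1 := (hs xs yd).2
    rw [L_eq_bot h] at h1
    by_cases hx : P.g xs = ⊤
    · rw [hP.L_eq_top hx hyd] at h1; simp at h1
    · rw [hP.L_eq_coe hx hyd] at h1
      exact EReal.coe_ne_bot _ (le_bot_iff.1 h1)
  refine ⟨xs, ys, hs, fun h => ?_, hy⟩
  have h1 := (hs xd ys).1
  rw [hP.L_eq_top h hy, hP.L_eq_coe hxd hy] at h1
  exact EReal.coe_ne_top _ (top_le_iff.1 h1)

/-- The saddle inequality in `x` at `ys` is itself an affine minorant of `g`, so no separation
theorem is needed; the other inequality does the same for `h*`. -/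
theorem g_minorant (hP : P.Standing) :
    ∃ (a : EuclideanSpace ℝ (Fin d)) (b : ℝ), ∀ u, ((inner ℝ a u + b : ℝ) : EReal) ≤ P.g u := by
  obtain ⟨xs, ys, hs, hx, hy⟩ := hP.exists_finite_saddle
  refine ⟨-P.mulAT ys, inner ℝ (P.mulA xs) ys + (P.g xs).toReal, fun u => ?_⟩
  by_cases hu : P.g u = ⊤
  · simp [hu]
  have h1 := (hs u ys).1
  rw [hP.L_eq_coe hx hy, hP.L_eq_coe hu hy, EReal.coe_le_coe_iff, P.inner_mulA u] at h1
  rw [← EReal.coe_toReal hu (hP.g_pcl.ne_bot _), EReal.coe_le_coe_iff, inner_neg_left,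
    real_inner_comm]
  linarith

theorem hstar_minorant (hP : P.Standing) :
    ∃ (a : EuclideanSpace ℝ (Fin n)) (b : ℝ), ∀ u, ((inner ℝ a u + b : ℝ) : EReal) ≤ P.hstar u := by
  obtain ⟨xs, ys, hs, hx, hy⟩ := hP.exists_finite_saddle
  refine ⟨P.mulA xs, (P.hstar ys).toReal - inner ℝ (P.mulA xs) ys, fun u => ?_⟩
  by_cases hu : P.hstar u = ⊤
  · simp [hu]
  have h1 := (hs xs u).2
  rw [hP.L_eq_coe hx hy, hP.L_eq_coe hx hu, EReal.coe_le_coe_iff] at h1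
  rw [← EReal.coe_toReal hu (hP.hstar_ne_bot _), EReal.coe_le_coe_iff]
  linarith

theorem h_minorant (hP : P.Standing) (i : Fin n) :
    ∃ a b : ℝ, ∀ u : ℝ, ((inner ℝ a u + b : ℝ) : EReal) ≤ P.h i u := by
  obtain ⟨xs, ys, hs, hx, hy⟩ := hP.exists_finite_saddle
  refine ⟨P.mulA xs i, (P.h i (ys i)).toReal - P.mulA xs i * ys i, fun u => ?_⟩
  by_cases hu : P.h i u = ⊤
  · simp [hu]
  -- Changing a single coordinate of `ys` isolates one summand of `h*` in the saddle inequality.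
  set y : EuclideanSpace ℝ (Fin n) := WithLp.toLp 2 (Function.update ys.ofLp i u)
  have hyi : y i = u := by simp [y]
  have hyj : ∀ j ≠ i, y j = ys j := fun j hj => by simp [y, hj]
  have hy' : P.hstar y ≠ ⊤ := by
    rw [hP.hstar_ne_top_iff] at hy ⊢
    intro j
    by_cases hj : j = i
    · subst hj; rwa [hyi]
    · rw [hyj j hj]; exact hy j
  have h1 := (hs xs y).2
  rw [hP.L_eq_coe hx hy, hP.L_eq_coe hx hy', EReal.coe_le_coe_iff, hP.hstar_toReal hy,
    hP.hstar_toReal hy', inner_mulA_eq_sum, inner_mulA_eq_sum] at h1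
  rw [← EReal.coe_toReal hu ((hP.h_pcl i).ne_bot _), EReal.coe_le_coe_iff]
  rw [← Finset.add_sum_erase _ _ (Finset.mem_univ i),
    ← Finset.add_sum_erase _ (fun j => (P.h j (y j)).toReal) (Finset.mem_univ i),
    ← Finset.add_sum_erase _ (fun j => P.mulA xs j * ys j) (Finset.mem_univ i),
    ← Finset.add_sum_erase _ (fun j => (P.h j (ys j)).toReal) (Finset.mem_univ i), hyi] at h1
  have e1 : ∑ j ∈ Finset.univ.erase i, P.mulA xs j * y j =
      ∑ j ∈ Finset.univ.erase i, P.mulA xs j * ys j :=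
    Finset.sum_congr rfl fun j hj => by rw [hyj j (Finset.ne_of_mem_erase hj)]
  have e2 : ∑ j ∈ Finset.univ.erase i, (P.h j (y j)).toReal =
      ∑ j ∈ Finset.univ.erase i, (P.h j (ys j)).toReal :=
    Finset.sum_congr rfl fun j hj => by rw [hyj j (Finset.ne_of_mem_erase hj)]
  rw [e1, e2] at h1
  have e3 : inner ℝ (P.mulA xs i) u = P.mulA xs i * u := by simp [mul_comm]
  rw [e3]
  linarith

end Standing

end Problem

/-! ### The weights -/

section Weights

theorem natCast_sub_one_ge_one (hn : 2 ≤ n) : (1 : ℝ) ≤ (n : ℝ) - 1 := by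
  have : (2 : ℝ) ≤ n := by exact_mod_cast hn
  linarith

theorem ratio_eq (hn : 2 ≤ n) : (n : ℝ) / ((n : ℝ) - 1) = 1 + 1 / ((n : ℝ) - 1) := by
  have := natCast_sub_one_ge_one hn
  field_simp
  ring

theorem one_lt_ratio (hn : 2 ≤ n) : 1 < (n : ℝ) / ((n : ℝ) - 1) := by
  have := natCast_sub_one_ge_one hn
  rw [ratio_eq hn]
  have : 0 < 1 / ((n : ℝ) - 1) := by positivity
  linarith

theorem ratio_le_two (hn : 2 ≤ n) : (n : ℝ) / ((n : ℝ) - 1) ≤ 2 := by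
  have := natCast_sub_one_ge_one hn
  rw [ratio_eq hn]
  have : 1 / ((n : ℝ) - 1) ≤ 1 := by rw [div_le_one (by linarith)]; exact this
  linarith

theorem lam_succ_eq (hn : 2 ≤ n) (k : ℕ) :
    lam n (k + 1) = min 1 (((n : ℝ) / ((n : ℝ) - 1)) ^ k / ((n : ℝ) - 1)) := by
  have h1 := natCast_sub_one_ge_one hn
  have hq := one_lt_ratio hn
  induction k with
  | zero =>
    rw [lam, pow_zero, min_eq_right]
    rw [div_le_one (by linarith)]; exact h1
  | succ k ih =>
    rw [lam, ih, mul_min_of_nonneg _ _ (by linarith), mul_one, ← min_assoc, min_eq_left hq.le,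
      pow_succ']
    ring_nf

theorem lam_pos (hn : 2 ≤ n) (k : ℕ) : 0 < lam n k := by
  have h1 := natCast_sub_one_ge_one hn
  have hq := one_lt_ratio hn
  cases k with
  | zero => simp [lam]
  | succ k =>
    rw [lam_succ_eq hn]
    exact lt_min one_pos (div_pos (pow_pos (by linarith) _) (by linarith))

theorem lam_le_one (hn : 2 ≤ n) (k : ℕ) : lam n k ≤ 1 := by
  cases k with
  | zero => simp [lam]
  | succ k => rw [lam_succ_eq hn]; exact min_le_left _ _

theorem mul_lam_succ_le (hn : 2 ≤ n) (k : ℕ) :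
    ((n : ℝ) - 1) * lam n (k + 2) ≤ n * lam n (k + 1) := by
  have h1 := natCast_sub_one_ge_one hn
  have h : lam n (k + 2) ≤ (n : ℝ) / ((n : ℝ) - 1) * lam n (k + 1) := by
    rw [lam]; exact min_le_right _ _
  have := mul_le_mul_of_nonneg_left h (by linarith : 0 ≤ (n : ℝ) - 1)
  refine this.trans_eq ?_
  field_simp

theorem mul_lam_one (hn : 2 ≤ n) : ((n : ℝ) - 1) * lam n 1 = 1 := by
  have h1 := natCast_sub_one_ge_one hn
  rw [lam]; field_simp

theorem Lam_succ (n K : ℕ) : Lam n (K + 1) = Lam n K + lam n K := Finset.sum_range_succ _ _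

theorem Lam_one (n : ℕ) : Lam n 1 = 1 := by simp [Lam, lam]

theorem Lam_pos (hn : 2 ≤ n) {K : ℕ} (hK : 1 ≤ K) : 0 < Lam n K :=
  Finset.sum_pos (fun k _ => lam_pos hn k) ⟨0, Finset.mem_range.2 hK⟩

/-- Below the cap, `λ_{k+1} = q^k/(n-1) = q^(k+1) - q^k` with `q = n/(n-1)`, so the sum telescopes.
-/
theorem Lam_eq_pow (hn : 2 ≤ n) (K : ℕ)
    (h : ∀ k < K, ((n : ℝ) / ((n : ℝ) - 1)) ^ k ≤ (n : ℝ) - 1) :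
    Lam n (K + 1) = ((n : ℝ) / ((n : ℝ) - 1)) ^ K := by
  have h1 := natCast_sub_one_ge_one hn
  induction K with
  | zero => simp [Lam_one]
  | succ K ih =>
    rw [Lam_succ, ih fun k hk => h k (by omega), lam_succ_eq hn, min_eq_right, pow_succ]
    · field_simp; ring
    · rw [div_le_one (by linarith)]; exact h K (by omega)

theorem inv_le_log_ratio (hn : 2 ≤ n) : 1 / (n : ℝ) ≤ Real.log ((n : ℝ) / ((n : ℝ) - 1)) := by
  have h1 := natCast_sub_one_ge_one hn
  have hq := one_lt_ratio hn
  -- The inverse ratio is `1 - 1/n`, which turns the upper bound for the logarithm into a lower one.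
  have h := Real.log_le_sub_one_of_pos (x := ((n : ℝ) / ((n : ℝ) - 1))⁻¹) (by positivity)
  rw [Real.log_inv] at h
  have h2 : ((n : ℝ) / ((n : ℝ) - 1))⁻¹ - 1 = - (1 / n) := by
    have : (0 : ℝ) < n := by linarith
    field_simp; ring
  linarith

theorem log_ratio_le_inv (hn : 2 ≤ n) :
    Real.log ((n : ℝ) / ((n : ℝ) - 1)) ≤ 1 / ((n : ℝ) - 1) := by
  have hq := one_lt_ratio hn
  have h := Real.log_le_sub_one_of_pos (x := (n : ℝ) / ((n : ℝ) - 1)) (by linarith)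
  rw [ratio_eq hn] at h ⊢
  linarith

theorem exp_div_le_ratio_pow (hn : 2 ≤ n) (K : ℕ) :
    Real.exp (K / n) ≤ ((n : ℝ) / ((n : ℝ) - 1)) ^ K := by
  have hq := one_lt_ratio hn
  rw [← Real.exp_log (by positivity : 0 < ((n : ℝ) / ((n : ℝ) - 1)) ^ K), Real.log_pow]
  apply Real.exp_le_exp.2
  have := mul_le_mul_of_nonneg_left (inv_le_log_ratio hn) (Nat.cast_nonneg (α := ℝ) K)
  rwa [mul_one_div] at this

theorem ratio_pow_le_exp_div (hn : 2 ≤ n) (K : ℕ) :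
    ((n : ℝ) / ((n : ℝ) - 1)) ^ K ≤ Real.exp (K / ((n : ℝ) - 1)) := by
  have hq := one_lt_ratio hn
  rw [← Real.exp_log (by positivity : 0 < ((n : ℝ) / ((n : ℝ) - 1)) ^ K), Real.log_pow]
  apply Real.exp_le_exp.2
  have := mul_le_mul_of_nonneg_left (log_ratio_le_inv hn) (Nat.cast_nonneg (α := ℝ) K)
  rwa [mul_one_div] at this

/-- The weights grow geometrically until they reach one and are constant afterwards. -/
theorem Lam_succ_cases (hn : 2 ≤ n) (K : ℕ) :
    (Lam n (K + 1) = ((n : ℝ) / ((n : ℝ) - 1)) ^ K ∧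
      ((n : ℝ) / ((n : ℝ) - 1)) ^ K < (n : ℝ) - 1) ∨
    ((n : ℝ) - 1 ≤ Lam n (K + 1) ∧
      (n : ℝ) - 1 + (K - 1 - n * Real.log ((n : ℝ) - 1)) ≤ Lam n (K + 1)) := by
  have h1 := natCast_sub_one_ge_one hn
  have hq := one_lt_ratio hn
  have hn0 : (0 : ℝ) < n := by linarith
  have hlog : 0 ≤ Real.log ((n : ℝ) - 1) := Real.log_nonneg h1
  have hex : ∃ m : ℕ, (n : ℝ) - 1 ≤ ((n : ℝ) / ((n : ℝ) - 1)) ^ m := by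
    obtain ⟨m, hm⟩ := pow_unbounded_of_one_lt ((n : ℝ) - 1) hq
    exact ⟨m, hm.le⟩
  classical
  -- `λ_{m+1}` is the first capped weight with index at least one; minimality of `m` bounds it by `1
  -- + n log(n-1)`.
  set m := Nat.find hex
  have hm : (n : ℝ) - 1 ≤ ((n : ℝ) / ((n : ℝ) - 1)) ^ m := Nat.find_spec hex
  have hlt : ∀ k < m, ((n : ℝ) / ((n : ℝ) - 1)) ^ k < (n : ℝ) - 1 := fun k hk =>
    not_le.1 (Nat.find_min hex hk)
  by_cases hK : K < m
  · exact Or.inl ⟨Lam_eq_pow hn K fun k hk => (hlt k (by omega)).le, hlt K hK⟩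
  right
  have hmb : (m : ℝ) ≤ 1 + n * Real.log ((n : ℝ) - 1) := by
    rcases Nat.eq_zero_or_pos m with h0 | h0
    · rw [h0]; push_cast; positivity
    · have h2 := (exp_div_le_ratio_pow hn (m - 1)).trans_lt (hlt (m - 1) (by omega))
      rw [← Real.lt_log_iff_exp_lt (by linarith), div_lt_iff₀ hn0, Nat.cast_sub h0] at h2
      push_cast at h2
      linarith
  have hsum : ∀ j : ℕ, Lam n (m + j + 1) = ((n : ℝ) / ((n : ℝ) - 1)) ^ m + j := by
    intro j
    induction j with
    | zero => simpa using Lam_eq_pow hn m fun k hk => (hlt k hk).le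
    | succ j ih =>
      rw [← add_assoc m j 1, Lam_succ, ih, lam_succ_eq hn, min_eq_left]
      · push_cast; ring
      · rw [le_div_iff₀ (by linarith), one_mul]
        exact hm.trans (pow_le_pow_right₀ hq.le (by omega))
  obtain ⟨j, rfl⟩ := Nat.exists_eq_add_of_le (not_lt.1 hK)
  rw [hsum]
  push_cast
  have : (0 : ℝ) ≤ j := Nat.cast_nonneg j
  constructor <;> linarith

/-- From `log x = 2 log √x ≤ 2√x - 2` and `(√x - 2)² ≥ 0`. -/
theorem log_le_half {x : ℝ} (hx : 0 < x) : Real.log x ≤ x / 2 := by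
  have h := Real.log_le_sub_one_of_pos (Real.sqrt_pos.2 hx)
  rw [Real.log_sqrt hx.le] at h
  nlinarith [Real.sq_sqrt hx.le, sq_nonneg (Real.sqrt x - 2)]

/-- With `q = n/(n-1)`, below the cap one factor `q ≤ 2` is lost. Beyond it, `q^(K-1)` has outgrown
`n - 1 ≤ Λ_K` by at most `exp(log(n-1)/(n-1)) ≤ e^(1/2) ≤ 3`. Together these give the constant 6. -/
theorem ratio_pow_le_Lam (hn : 2 ≤ n) {K : ℕ} (hK : 1 ≤ K)
    (h : (K : ℝ) ≤ 1 + n * Real.log ((n : ℝ) - 1)) :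
    ((n : ℝ) / ((n : ℝ) - 1)) ^ K ≤ 6 * Lam n K := by
  obtain ⟨K, rfl⟩ := Nat.exists_eq_add_of_le' hK
  have h1 := natCast_sub_one_ge_one hn
  have hq := one_lt_ratio hn
  have hq2 := ratio_le_two hn
  rcases Lam_succ_cases hn K with ⟨h2, -⟩ | ⟨h2, -⟩
  · rw [h2, pow_succ]
    have : 0 < ((n : ℝ) / ((n : ℝ) - 1)) ^ K := by positivity
    nlinarith
  · push_cast at h
    have hl := log_le_half (x := (n : ℝ) - 1) (by linarith)
    have h3 : ((n : ℝ) / ((n : ℝ) - 1)) ^ K ≤ ((n : ℝ) - 1) * Real.exp (1 / 2) := by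
      refine (ratio_pow_le_exp_div hn K).trans ?_
      nth_rw 2 [← Real.exp_log (by linarith : 0 < (n : ℝ) - 1)]
      rw [← Real.exp_add]
      apply Real.exp_le_exp.2
      rw [div_le_iff₀ (by linarith)]
      nlinarith
    have h4 : Real.exp (1 / 2) ≤ 3 := by
      refine (Real.exp_le_exp.2 (by norm_num : (1 / 2 : ℝ) ≤ 1)).trans ?_
      linarith [Real.exp_one_lt_d9]
    rw [pow_succ]
    calc _ ≤ ((n : ℝ) - 1) * 3 * 2 := by
          gcongr
          refine h3.trans (by gcongr)
      _ ≤ _ := by linarith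

/-- If the cap is not reached although `K > K₀`, then `Λ_K = q^(K-1) ≥ (n-1)/4`, while the left side
is at most `n - 1 + log(n-1) ≤ 3(n-1)/2`. Past the cap, the left side exceeds `Λ_K` by at most `1 +
log(n-1)`, which is absorbed because `Λ_K ≥ n - 1`. -/
theorem linear_le_Lam (hn : 2 ≤ n) {K : ℕ} (hK : 1 ≤ K) {K₀ : ℝ}
    (h0 : ((n : ℝ) - 1) * Real.log ((n : ℝ) - 1) ≤ K₀) (h : K₀ < K) :
    (K : ℝ) - K₀ - 1 + ((n : ℝ) - 1) ^ 2 / n ≤ 6 * Lam n K := by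
  obtain ⟨K, rfl⟩ := Nat.exists_eq_add_of_le' hK
  have h1 := natCast_sub_one_ge_one hn
  have hn0 : (0 : ℝ) < n := by linarith
  have hq := one_lt_ratio hn
  have hq2 := ratio_le_two hn
  have hl := log_le_half (x := (n : ℝ) - 1) (by linarith)
  have hl0 : 0 ≤ Real.log ((n : ℝ) - 1) := Real.log_nonneg h1
  have hN : ((n : ℝ) - 1) ^ 2 / n ≤ (n : ℝ) - 1 := by
    rw [div_le_iff₀ hn0]; nlinarith
  push_cast at h ⊢
  rcases Lam_succ_cases hn K with ⟨h2, h3⟩ | ⟨h2, h3⟩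
  · have h4 := (exp_div_le_ratio_pow hn K).trans_lt h3
    rw [← Real.lt_log_iff_exp_lt (by linarith), div_lt_iff₀ hn0] at h4
    have h5 : ((n : ℝ) - 1) / 2 ≤ ((n : ℝ) / ((n : ℝ) - 1)) ^ (K + 1) := by
      have h6 : ((n : ℝ) - 1) * Real.exp (-(1 / 2)) ≤ ((n : ℝ) / ((n : ℝ) - 1)) ^ (K + 1) := by
        refine le_trans ?_ (exp_div_le_ratio_pow hn (K + 1))
        nth_rw 1 [← Real.exp_log (by linarith : 0 < (n : ℝ) - 1)]
        rw [← Real.exp_add]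
        apply Real.exp_le_exp.2
        rw [le_div_iff₀ hn0]
        push_cast
        nlinarith
      have h7 := Real.add_one_le_exp (-(1 / 2 : ℝ))
      nlinarith
    rw [pow_succ] at h5
    have h8 : 0 < ((n : ℝ) / ((n : ℝ) - 1)) ^ K := by positivity
    rw [h2]
    nlinarith
  · nlinarith

theorem linear_denominator_pos (hn : 2 ≤ n) {K : ℕ} (hK : 2 ≤ K) {K₀ : ℝ}
    (h0 : K₀ ≤ 1 + n * Real.log ((n : ℝ) - 1)) (h : K₀ < K) :
    0 < (K : ℝ) - K₀ - 1 + ((n : ℝ) - 1) ^ 2 / n := by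
  rcases eq_or_lt_of_le hn with rfl | hn
  -- For `n = 2` the logarithm vanishes and the last summand is only 1/2, so positivity comes from
  -- `K₀ ≤ 1` and `K ≥ 2`.
  · have : (2 : ℝ) ≤ K := by exact_mod_cast hK
    norm_num at h0 ⊢
    linarith
  · have h3 : (3 : ℝ) ≤ n := by exact_mod_cast hn
    have : 1 ≤ ((n : ℝ) - 1) ^ 2 / n := by
      rw [le_div_iff₀ (by linarith)]; nlinarith
    linarith

/-- The number of iterations after which the weights add up to at least `c * r`. -/
theorem mul_le_Lam (hn : 2 ≤ n) {c r : ℝ} (hc : 1 ≤ c) (hr : 0 ≤ r) {K : ℕ}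
    (h : 2 + n * (c * min (Real.log n) (Real.log (1 + r))) + c * r ≤ K) : c * r ≤ Lam n K := by
  have h1 := natCast_sub_one_ge_one hn
  have hn0 : (0 : ℝ) < n := by linarith
  have hcr : 0 ≤ c * r := by positivity
  have hlogn : 0 ≤ Real.log n := Real.log_nonneg (by linarith)
  -- Bernoulli: `1 + c r ≤ (1 + r)^c`. This moves the constant `c` out of the logarithm.
  have hb : Real.log (1 + c * r) ≤ c * Real.log (1 + r) := by
    rw [← Real.log_rpow (by linarith)]
    exact Real.log_le_log (by linarith) (one_add_mul_self_le_rpow_one_add (by linarith) hc)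
  have hmin : min (Real.log n) (Real.log (1 + c * r)) ≤
      c * min (Real.log n) (Real.log (1 + r)) := by
    rw [mul_min_of_nonneg _ _ (by linarith)]
    exact min_le_min (by nlinarith) hb
  have hmin0 : 0 ≤ min (Real.log n) (Real.log (1 + c * r)) :=
    le_min hlogn (Real.log_nonneg (by linarith))
  have hm := mul_le_mul_of_nonneg_left hmin hn0.le
  have hm0 := mul_nonneg hn0.le hmin0
  have hK1 : 1 ≤ K := by
    have : (1 : ℝ) ≤ K := by linarith
    exact_mod_cast this
  obtain ⟨K, rfl⟩ := Nat.exists_eq_add_of_le' hK1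
  push_cast at h
  have hlog : Real.log ((n : ℝ) - 1) ≤ Real.log n := Real.log_le_log (by linarith) (by linarith)
  rcases Lam_succ_cases hn K with ⟨h2, h3⟩ | ⟨h2, h3⟩
  · have h4 : min (Real.log n) (Real.log (1 + c * r)) ≤ K / n := by
      rw [le_div_iff₀ hn0]; linarith
    have h5 := (Real.exp_le_exp.2 h4).trans (exp_div_le_ratio_pow hn K)
    -- Below the cap the power is less than `n - 1`, so the minimum cannot be `log n`;
    -- exponentiating the other choice gives the bound.
    rcases min_choice (Real.log n) (Real.log (1 + c * r)) with h6 | h6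
    · rw [h6, Real.exp_log hn0] at h5; linarith
    · rw [h6, Real.exp_log (by linarith)] at h5; linarith
  · by_cases h4 : c * r ≤ (n : ℝ) - 1
    · linarith
    · have h5 : min (Real.log n) (Real.log (1 + c * r)) = Real.log n :=
        min_eq_left (Real.log_le_log hn0 (by linarith))
      rw [h5] at hm
      have := mul_le_mul_of_nonneg_left hlog hn0.le
      linarith

end Weights

/-! ### One iteration -/

theorem sum_comp_update (F : Fin n → ℝ → ℝ) (u : Fin n → ℝ) (i : Fin n) (v : ℝ) :
    ∑ j, F j (Function.update u i v j) = ∑ j, F j (u j) + (F i v - F i (u i)) := by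
  rw [← Finset.add_sum_erase _ _ (Finset.mem_univ i),
    ← Finset.add_sum_erase _ (fun j => F j (u j)) (Finset.mem_univ i), Function.update_self]
  rw [Finset.sum_congr rfl fun j hj => by
    rw [Function.update_of_ne (Finset.ne_of_mem_erase hj)]]
  ring

/-- The primal proximal point computed from the state `s` with the weight `l`. -/
def primalProx (P : Problem n d) (l : ℝ) (s : Iterate n d) : EuclideanSpace ℝ (Fin d) :=
  prox (tau P * l) P.g (s.x - (tau P * l) • P.mulAT s.y)

/-- The full dual update from the state `s` with the weight `l`. -/
def dualProx (P : Problem n d) (γ l : ℝ) (s : Iterate n d) (j : Fin n) : ℝ :=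
  prox (l * sigma P γ j) (P.h j) (s.y j + l * sigma P γ j * P.mulA (primalProx P l s) j)

/-- The iteration of the algorithm with weight `l` and picked coordinate `i`. -/
def weightedStep (P : Problem n d) (γ l : ℝ) (i : Fin n) (s : Iterate n d) : Iterate n d :=
  step P (tau P * l) (fun j => l * sigma P γ j) (fun _ => 1 / (n : ℝ)) i s

theorem weightedStep_xbar (P : Problem n d) (γ l : ℝ) (i : Fin n) (s : Iterate n d) :
    (weightedStep P γ l i s).xbar = primalProx P l s := rfl

theorem weightedStep_y (P : Problem n d) (γ l : ℝ) (i : Fin n) (s : Iterate n d) :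
    (weightedStep P γ l i s).y =
      WithLp.toLp 2 (Function.update s.y.ofLp i (dualProx P γ l s i)) := rfl

/-- Only one dual entry changes, so the correction is a multiple of one row of `A`; this also keeps
the cost of an iteration linear in `d`. -/
theorem weightedStep_x (P : Problem n d) (γ l : ℝ) (i : Fin n) (s : Iterate n d) :
    (weightedStep P γ l i s).x = primalProx P l s -
      (tau P * l * (n * (dualProx P γ l s i - s.y i))) • P.row i := by
  have h : (WithLp.toLp 2 fun j => (1 / (n : ℝ))⁻¹ * ((weightedStep P γ l i s).y j - s.y j) :
      EuclideanSpace ℝ (Fin n)) =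
      EuclideanSpace.single i (n * (dualProx P γ l s i - s.y i)) := by
    ext j
    rw [weightedStep_y]
    by_cases hj : j = i
    · subst hj; simp
    · simp [hj]
  have h2 : (weightedStep P γ l i s).x = primalProx P l s - (tau P * l) • P.mulAT
      (WithLp.toLp 2 fun j => (1 / (n : ℝ))⁻¹ * ((weightedStep P γ l i s).y j - s.y j)) := rfl
  rw [h2, h, P.mulAT_single, smul_smul]

section Inequalities

variable {P : Problem n d} {γ l : ℝ}

theorem tau_pos (hn : 2 ≤ n) (hA : ∀ i, P.A i ≠ 0) : 0 < tau P := by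
  have := P.maxRowNorm_pos hn hA
  have hn0 : (0 : ℝ) < n := by exact_mod_cast (by omega : 0 < n)
  unfold tau; positivity

theorem sigma_pos (hA : ∀ i, P.A i ≠ 0) (hγ : 0 < γ) (i : Fin n) : 0 < sigma P γ i :=
  div_pos hγ (P.rowNorm_pos hA i)

theorem g_primalProx_ne_top (hn : 2 ≤ n) (hP : P.Standing) (hA : ∀ i, P.A i ≠ 0) (hl : 0 < l)
    (s : Iterate n d) : P.g (primalProx P l s) ≠ ⊤ := by
  obtain ⟨a, b, hab⟩ := hP.g_minorant
  exact (prox_spec hP.g_pcl hab (mul_pos (tau_pos hn hA) hl) _).1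

theorem h_dualProx_ne_top (hP : P.Standing) (hA : ∀ i, P.A i ≠ 0) (hγ : 0 < γ) (hl : 0 < l)
    (s : Iterate n d) (j : Fin n) : P.h j (dualProx P γ l s j) ≠ ⊤ := by
  obtain ⟨a, b, hab⟩ := hP.h_minorant j
  exact (prox_spec (hP.h_pcl j) hab (mul_pos hl (sigma_pos hA hγ j)) _).1

/-- Expanding the square of `x - x_{k+1}` around the proximal point yields the cross term `n δ (A
xbar - A x)_i`. It completes the coupling with the old dual vector `s.y`, so no extrapolation is
needed, and leaves only the quadratic error on the right. -/
theorem primal_step_le (hn : 2 ≤ n) (hP : P.Standing) (hA : ∀ i, P.A i ≠ 0) (hl : 0 < l)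
    (s : Iterate n d) (i : Fin n) {x : EuclideanSpace ℝ (Fin d)} (hx : P.g x ≠ ⊤) :
    l * ((P.g (primalProx P l s)).toReal - (P.g x).toReal
      + ∑ j, (P.mulA (primalProx P l s) j - P.mulA x j) * s.y j
      + n * (dualProx P γ l s i - s.y i) * (P.mulA (primalProx P l s) i - P.mulA x i)) ≤
    1 / (2 * tau P) * (‖x - s.x‖ ^ 2 - ‖x - (weightedStep P γ l i s).x‖ ^ 2)
      + tau P * l ^ 2 * n ^ 2 / 2 * P.rowNorm i ^ 2 * (dualProx P γ l s i - s.y i) ^ 2 := by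
  obtain ⟨a, b, hab⟩ := hP.g_minorant
  have hτ := tau_pos (P := P) hn hA
  have h1 := (prox_spec hP.g_pcl hab (mul_pos hτ hl) (s.x - (tau P * l) • P.mulAT s.y)).2 x hx
  change (P.g (primalProx P l s)).toReal - (P.g x).toReal ≤ 1 / (tau P * l) *
    inner ℝ (primalProx P l s - (s.x - (tau P * l) • P.mulAT s.y)) (x - primalProx P l s) at h1
  rw [weightedStep_x]
  set xb := primalProx P l s
  set δ := dualProx P γ l s i - s.y i
  set r := P.row i
  have h2 : xb - (s.x - (tau P * l) • P.mulAT s.y) = (xb - s.x) + (tau P * l) • P.mulAT s.y := by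
    module
  rw [h2, inner_add_left, inner_smul_left] at h1
  have h3 : inner ℝ (P.mulAT s.y) (x - xb) = -∑ j, (P.mulA xb j - P.mulA x j) * s.y j := by
    rw [real_inner_comm, ← P.inner_mulA, P.inner_mulA_eq_sum, P.mulA_sub, ← Finset.sum_neg_distrib]
    exact Finset.sum_congr rfl fun j _ => by simp; ring
  have h4 : ‖x - s.x‖ ^ 2 = ‖x - xb‖ ^ 2 + 2 * inner ℝ (xb - s.x) (x - xb) + ‖xb - s.x‖ ^ 2 := by
    have : x - s.x = (x - xb) + (xb - s.x) := by abel
    rw [this, norm_add_sq_real, real_inner_comm]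
  have h5 : ‖x - (xb - (tau P * l * (n * δ)) • r)‖ ^ 2 = ‖x - xb‖ ^ 2
      + 2 * (tau P * l * (n * δ)) * (P.mulA x i - P.mulA xb i)
      + (tau P * l * (n * δ)) ^ 2 * P.rowNorm i ^ 2 := by
    have : x - (xb - (tau P * l * (n * δ)) • r) = (x - xb) + (tau P * l * (n * δ)) • r := by module
    rw [this, norm_add_sq_real, inner_smul_right, norm_smul, mul_pow, Real.norm_eq_abs, sq_abs,
      real_inner_comm, inner_sub_right, ← P.mulA_apply, ← P.mulA_apply]
    change _ + _ * ‖P.row i‖ ^ 2 = _ + _ * ‖P.row i‖ ^ 2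
    ring
  rw [h3] at h1
  simp only [conj_trivial] at h1
  set B := ∑ j, (P.mulA xb j - P.mulA x j) * s.y j
  rw [h4, h5]
  have h6 := mul_le_mul_of_nonneg_left h1 hl.le
  have h7 : l * (1 / (tau P * l) * (inner ℝ (xb - s.x) (x - xb) + tau P * l * -B)) =
      1 / tau P * inner ℝ (xb - s.x) (x - xb) - l * B := by
    field_simp
    ring
  rw [h7] at h6
  have h8 : 1 / (2 * tau P) * (‖x - xb‖ ^ 2 + 2 * inner ℝ (xb - s.x) (x - xb) + ‖xb - s.x‖ ^ 2
      - (‖x - xb‖ ^ 2 + 2 * (tau P * l * (n * δ)) * (P.mulA x i - P.mulA xb i)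
      + (tau P * l * (n * δ)) ^ 2 * P.rowNorm i ^ 2))
      + tau P * l ^ 2 * n ^ 2 / 2 * P.rowNorm i ^ 2 * δ ^ 2
      = 1 / tau P * inner ℝ (xb - s.x) (x - xb) + 1 / (2 * tau P) * ‖xb - s.x‖ ^ 2
        + l * n * δ * (P.mulA xb i - P.mulA x i) := by
    field_simp
    ring
  rw [h8]
  have h9 : 0 ≤ 1 / (2 * tau P) * ‖xb - s.x‖ ^ 2 := by positivity
  nlinarith

/-- Needed for every coordinate, picked or not: the unpicked ones enter through the average. The
outer factor `l` cancels the `l` in the step size, so the metric `‖A_j‖/γ` is the same in all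
iterations. -/
theorem dual_step_le (hP : P.Standing) (hA : ∀ i, P.A i ≠ 0) (hγ : 0 < γ) (hl : 0 < l)
    (s : Iterate n d) (j : Fin n) {t : ℝ} (ht : P.h j t ≠ ⊤) :
    l * ((P.h j (dualProx P γ l s j)).toReal - (P.h j t).toReal) ≤
      P.rowNorm j / γ * (dualProx P γ l s j - s.y j) * (t - dualProx P γ l s j)
      - l * P.mulA (primalProx P l s) j * (t - dualProx P γ l s j) := by
  obtain ⟨a, b, hab⟩ := hP.h_minorant j
  have hσ := sigma_pos (P := P) hA hγ j
  have h1 := (prox_spec (hP.h_pcl j) hab (mul_pos hl hσ)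
    (s.y j + l * sigma P γ j * P.mulA (primalProx P l s) j)).2 t ht
  change (P.h j (dualProx P γ l s j)).toReal - (P.h j t).toReal ≤ 1 / (l * sigma P γ j) *
    ((t - dualProx P γ l s j) *
      (dualProx P γ l s j - (s.y j + l * sigma P γ j * P.mulA (primalProx P l s) j))) at h1
  have h2 := mul_le_mul_of_nonneg_left h1 hl.le
  refine h2.trans_eq ?_
  have hR := P.rowNorm_pos hA j
  unfold sigma
  field_simp
  ring

/-- The part of the error of an iteration that averages to zero is `∑ j, c j - n * c i`, where `c` is
this vector. -/
def fluctuation (P : Problem n d) (γ : ℝ) (y0 : EuclideanSpace ℝ (Fin n)) (l : ℝ) (s : Iterate n d)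
    (j : Fin n) : ℝ :=
  -(1 / 2) * (P.rowNorm j / γ) * (dualProx P γ l s j ^ 2 - s.y j ^ 2)
    + l * P.mulA (primalProx P l s) j * (dualProx P γ l s j - s.y j)
    - l * ((P.h j (dualProx P γ l s j)).toReal - (P.h j (s.y j)).toReal)
    + P.rowNorm j / γ * (dualProx P γ l s j - s.y j) * y0 j

/-- The error of an iteration that does not depend on the point of comparison. -/
def stepError (P : Problem n d) (γ : ℝ) (y0 : EuclideanSpace ℝ (Fin n)) (l : ℝ) (s : Iterate n d)
    (i : Fin n) : ℝ :=
  tau P * l ^ 2 * n ^ 2 / 2 * P.rowNorm i ^ 2 * (dualProx P γ l s i - s.y i) ^ 2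
    - 1 / 2 * ∑ j, P.rowNorm j / γ * (dualProx P γ l s j - s.y j) ^ 2
    + (∑ j, fluctuation P γ y0 l s j - n * fluctuation P γ y0 l s i)

/-- The error of an iteration is linear in the dual point of comparison, with these coefficients. -/
def stepNoise (P : Problem n d) (γ l : ℝ) (s : Iterate n d) (i j : Fin n) : ℝ :=
  P.rowNorm j / γ * (dualProx P γ l s j - s.y j)
    - if j = i then n * (P.rowNorm j / γ * (dualProx P γ l s j - s.y j)) else 0

/-- The dual objective `h*(u) - ⟨A x, u⟩`. -/
def dualObj (P : Problem n d) (x : EuclideanSpace ℝ (Fin d)) (u : EuclideanSpace ℝ (Fin n)) : ℝ :=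
  ∑ j, ((P.h j (u j)).toReal - P.mulA x j * u j)

/-- All dual inequalities are added to the primal one. Terms that involve only the picked coordinate
are replaced by their average over all coordinates, and the difference goes into `stepNoise`, which
multiplies `y - y0`, and `stepError`, which is free of `x` and `y`. Centring at `y0` lets the later
Young estimate cost only `‖y - y0‖²`. -/
theorem step_le (hn : 2 ≤ n) (hP : P.Standing) (hA : ∀ i, P.A i ≠ 0) (hγ : 0 < γ) (hl : 0 < l)
    (y0 : EuclideanSpace ℝ (Fin n)) (s : Iterate n d) (i : Fin n) {x : EuclideanSpace ℝ (Fin d)}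
    (hx : P.g x ≠ ⊤) {y : EuclideanSpace ℝ (Fin n)} (hy : P.hstar y ≠ ⊤) :
    l * ((P.g (primalProx P l s)).toReal - (P.g x).toReal
      + ∑ j, (P.mulA (primalProx P l s) j * y j - (P.h j (y j)).toReal)
      + n * dualObj P x (weightedStep P γ l i s).y - (n - 1) * dualObj P x s.y) ≤
    1 / (2 * tau P) * (‖x - s.x‖ ^ 2 - ‖x - (weightedStep P γ l i s).x‖ ^ 2)
      + n / 2 * (∑ j, P.rowNorm j / γ * (y j - s.y j) ^ 2
        - ∑ j, P.rowNorm j / γ * (y j - (weightedStep P γ l i s).y j) ^ 2)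
      + ∑ j, (y j - y0 j) * stepNoise P γ l s i j + stepError P γ y0 l s i := by
  rw [hP.hstar_ne_top_iff] at hy
  have hprimal := primal_step_le (γ := γ) hn hP hA hl s i hx
  have hdual := Finset.sum_le_sum fun j (_ : j ∈ Finset.univ) =>
    dual_step_le hP hA hγ hl s j (hy j)
  have hobj : dualObj P x (weightedStep P γ l i s).y = dualObj P x s.y
      + (((P.h i (dualProx P γ l s i)).toReal - P.mulA x i * dualProx P γ l s i)
        - ((P.h i (s.y i)).toReal - P.mulA x i * s.y i)) :=
    sum_comp_update (fun j u => (P.h j u).toReal - P.mulA x j * u) s.y.ofLp i _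
  have hdist : ∑ j, P.rowNorm j / γ * (y j - (weightedStep P γ l i s).y j) ^ 2 =
      ∑ j, P.rowNorm j / γ * (y j - s.y j) ^ 2 + (P.rowNorm i / γ * (y i - dualProx P γ l s i) ^ 2
        - P.rowNorm i / γ * (y i - s.y i) ^ 2) :=
    sum_comp_update (fun j u => P.rowNorm j / γ * (y j - u) ^ 2) s.y.ofLp i _
  have hnoise : ∑ j, (y j - y0 j) * stepNoise P γ l s i j =
      ∑ j, (y j - y0 j) * (P.rowNorm j / γ * (dualProx P γ l s j - s.y j))
        - (y i - y0 i) * (n * (P.rowNorm i / γ * (dualProx P γ l s i - s.y i))) := by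
    simp [stepNoise, mul_sub, Finset.sum_sub_distrib]
  rw [hobj, hdist, hnoise]
  set X := 1 / (2 * tau P) * (‖x - s.x‖ ^ 2 - ‖x - (weightedStep P γ l i s).x‖ ^ 2)
  simp only [stepError, dualObj]
  set E := tau P * l ^ 2 * n ^ 2 / 2 * P.rowNorm i ^ 2 * (dualProx P γ l s i - s.y i) ^ 2
  have hfl : fluctuation P γ y0 l s i = -(1 / 2) * (P.rowNorm i / γ) *
      (dualProx P γ l s i ^ 2 - s.y i ^ 2)
      + l * P.mulA (primalProx P l s) i * (dualProx P γ l s i - s.y i)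
      - l * ((P.h i (dualProx P γ l s i)).toReal - (P.h i (s.y i)).toReal)
      + P.rowNorm i / γ * (dualProx P γ l s i - s.y i) * y0 i := rfl
  have hsum : ∑ j, (y j - y0 j) * (P.rowNorm j / γ * (dualProx P γ l s j - s.y j))
      - 1 / 2 * ∑ j, P.rowNorm j / γ * (dualProx P γ l s j - s.y j) ^ 2
      + ∑ j, fluctuation P γ y0 l s j =
      ∑ j, (P.rowNorm j / γ * (dualProx P γ l s j - s.y j) * (y j - dualProx P γ l s j)
        - l * P.mulA (primalProx P l s) j * (y j - dualProx P γ l s j))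
      - ∑ j, l * ((P.h j (dualProx P γ l s j)).toReal - (P.h j (y j)).toReal)
      - l * ∑ j, (P.mulA (primalProx P l s) j - P.mulA x j) * s.y j
      + l * ∑ j, (P.mulA (primalProx P l s) j * y j - (P.h j (y j)).toReal)
      + l * ∑ j, ((P.h j (s.y j)).toReal - P.mulA x j * s.y j) := by
    simp only [Finset.mul_sum, ← Finset.sum_sub_distrib, ← Finset.sum_add_distrib]
    refine Finset.sum_congr rfl fun j _ => ?_
    rw [fluctuation]
    ring
  rw [hfl]
  linarith

/-- The dual potential of accumulated noise `S`. -/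
def noisePotential (P : Problem n d) (γ : ℝ) (S : Fin n → ℝ) : ℝ :=
  (1 - γ) / (2 * ((n : ℝ) - 1)) * ∑ j, S j ^ 2 / (P.rowNorm j / γ)

/-- On average over the picked coordinate, one iteration does not increase the accumulated error. -/
theorem sum_potential_le (hn : 2 ≤ n) (hA : ∀ i, P.A i ≠ 0) (hγ : 0 < γ)
    (hl : 0 < l) (hl1 : l ≤ 1) (y0 : EuclideanSpace ℝ (Fin n)) (s : Iterate n d) (S : Fin n → ℝ)
    (T : ℝ) :
    ∑ i, (T + stepError P γ y0 l s i + noisePotential P γ fun j => S j + stepNoise P γ l s i j) ≤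
      n * (T + noisePotential P γ S) := by
  have hN := natCast_sub_one_ge_one hn
  have hn0 : (0 : ℝ) < n := by linarith
  have hM := P.maxRowNorm_pos hn hA
  -- The noise in coordinate `j` is `e` if `i ≠ j` and `-(n-1) e` if `i = j`. The cross terms cancel
  -- and the squares add up to `n (n-1) e²`.
  have hsq : ∀ j, ∑ i, (S j + stepNoise P γ l s i j) ^ 2 / (P.rowNorm j / γ) =
      n * (S j ^ 2 / (P.rowNorm j / γ))
        + n * (n - 1) * (P.rowNorm j / γ * (dualProx P γ l s j - s.y j) ^ 2) := by
    intro j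
    have hR := P.rowNorm_pos hA j
    set e := P.rowNorm j / γ * (dualProx P γ l s j - s.y j) with he
    have h1 : ∀ i, (S j + stepNoise P γ l s i j) ^ 2 / (P.rowNorm j / γ) =
        (S j + e) ^ 2 / (P.rowNorm j / γ)
          + if j = i then (n ^ 2 * e ^ 2 - 2 * n * e * (S j + e)) / (P.rowNorm j / γ) else 0 := by
      intro i
      rw [stepNoise]
      split_ifs
      · ring
      · ring
    rw [Finset.sum_congr rfl fun i _ => h1 i, Finset.sum_add_distrib, Finset.sum_ite_eq]
    simp only [Finset.sum_const, Finset.card_univ, Fintype.card_fin, nsmul_eq_mul,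
      Finset.mem_univ, if_true]
    rw [he]
    field_simp
    ring
  -- The factor `(1-γ)/(2(n-1))` in the potential reduces the variance `n - 1` to exactly the share
  -- `(1-γ)/2` of the available negative term.
  have hpot : ∑ i, noisePotential P γ (fun j => S j + stepNoise P γ l s i j) =
      n * noisePotential P γ S
        + n * ((1 - γ) / 2 * ∑ j, P.rowNorm j / γ * (dualProx P γ l s j - s.y j) ^ 2) := by
    simp only [noisePotential]
    rw [← Finset.mul_sum, Finset.sum_comm, Finset.sum_congr rfl fun j _ => hsq j,
      Finset.sum_add_distrib, ← Finset.mul_sum, ← Finset.mul_sum]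
    have : (n : ℝ) - 1 ≠ 0 := by linarith
    field_simp
  have herr : ∑ i, stepError P γ y0 l s i =
      ∑ j, (tau P * l ^ 2 * n ^ 2 / 2 * P.rowNorm j ^ 2 * (dualProx P γ l s j - s.y j) ^ 2)
        - n * (1 / 2 * ∑ j, P.rowNorm j / γ * (dualProx P γ l s j - s.y j) ^ 2) := by
    simp only [stepError, Finset.sum_add_distrib, Finset.sum_sub_distrib, Finset.sum_const,
      Finset.card_univ, Fintype.card_fin, nsmul_eq_mul, ← Finset.mul_sum]
    ring
  -- `τ n ‖A_j‖ ≤ 1` and `l ≤ 1` keep the primal correction within the remaining share `γ/2`; this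
  -- is where the cap on the weights is used.
  have hle : ∑ j, (tau P * l ^ 2 * n ^ 2 / 2 * P.rowNorm j ^ 2 *
      (dualProx P γ l s j - s.y j) ^ 2) ≤
      n * (γ / 2 * ∑ j, P.rowNorm j / γ * (dualProx P γ l s j - s.y j) ^ 2) := by
    rw [Finset.mul_sum, Finset.mul_sum]
    refine Finset.sum_le_sum fun j _ => ?_
    have hR := P.rowNorm_pos hA j
    have h1 : tau P * l ^ 2 * n ^ 2 / 2 * P.rowNorm j ^ 2 ≤ n / 2 * P.rowNorm j := by
      have h2 : tau P * n * P.rowNorm j ≤ 1 := by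
        have : tau P * n * P.rowNorm j = P.rowNorm j / P.maxRowNorm := by
          unfold tau; field_simp
        rw [this, div_le_one hM]
        exact P.rowNorm_le j
      have h3 : l ^ 2 ≤ 1 := pow_le_one₀ hl.le hl1
      have h4 : tau P * n * P.rowNorm j * l ^ 2 ≤ 1 * 1 := by gcongr
      have h5 := mul_le_mul_of_nonneg_right h4 (by positivity : 0 ≤ n / 2 * P.rowNorm j)
      linarith
    refine (mul_le_mul_of_nonneg_right h1 (sq_nonneg _)).trans_eq ?_
    field_simp
  rw [Finset.sum_add_distrib, Finset.sum_add_distrib, hpot, herr]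
  simp only [Finset.sum_const, Finset.card_univ, Fintype.card_fin, nsmul_eq_mul]
  nlinarith

end Inequalities

/-! ### The path of the iterates -/

section Path

variable {P : Problem n d} {γ : ℝ}

theorem iterates_add_two (P : Problem n d) (γ : ℝ) (x0 : EuclideanSpace ℝ (Fin d))
    (y0 : EuclideanSpace ℝ (Fin n)) (ι : ℕ → Fin n) (k : ℕ) :
    iterates P γ x0 y0 ι (k + 2) =
      weightedStep P γ (lam n (k + 1)) (ι (k + 1)) (iterates P γ x0 y0 ι (k + 1)) := rfl

theorem sigmaInit_pos (hn : 2 ≤ n) (hA : ∀ i, P.A i ≠ 0) (hγ : 0 < γ) : 0 < sigmaInit P γ := by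
  have := P.maxRowNorm_pos hn hA
  have hn0 : (0 : ℝ) < n := by exact_mod_cast (by omega : 0 < n)
  unfold sigmaInit; positivity

theorem iterates_mem_dom (hn : 2 ≤ n) (hP : P.Standing) (hA : ∀ i, P.A i ≠ 0) (hγ : 0 < γ)
    (x0 : EuclideanSpace ℝ (Fin d)) (y0 : EuclideanSpace ℝ (Fin n)) (ι : ℕ → Fin n) (k : ℕ) :
    P.g (iterates P γ x0 y0 ι (k + 1)).xbar ≠ ⊤ ∧ P.hstar (iterates P γ x0 y0 ι (k + 1)).y ≠ ⊤ := by
  induction k with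
  | zero =>
    obtain ⟨a, b, hab⟩ := hP.g_minorant
    obtain ⟨a', b', hab'⟩ := hP.hstar_minorant
    exact ⟨(prox_spec hP.g_pcl hab (tau_pos hn hA) _).1,
      (prox_spec hP.hstar_pcl hab' (sigmaInit_pos hn hA hγ) _).1⟩
  | succ k ih =>
    have hl := lam_pos hn (k + 1)
    rw [iterates_add_two]
    refine ⟨g_primalProx_ne_top hn hP hA hl _, ?_⟩
    have h := ih.2
    rw [hP.hstar_ne_top_iff] at h ⊢
    intro j
    rw [weightedStep_y]
    by_cases hj : j = ι (k + 1)
    · subst hj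
      simpa using h_dualProx_ne_top hP hA hγ hl _ _
    · simpa [hj] using h j

/-- The sum of the noise of the iterations before iteration `K`. -/
def pathNoise (P : Problem n d) (γ : ℝ) (x0 : EuclideanSpace ℝ (Fin d))
    (y0 : EuclideanSpace ℝ (Fin n)) (ι : ℕ → Fin n) (K : ℕ) (j : Fin n) : ℝ :=
  ∑ k ∈ Finset.Ico 1 K, stepNoise P γ (lam n k) (iterates P γ x0 y0 ι k) (ι k) j

/-- The sum of the errors of the iterations before iteration `K`. -/
def pathError (P : Problem n d) (γ : ℝ) (x0 : EuclideanSpace ℝ (Fin d))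
    (y0 : EuclideanSpace ℝ (Fin n)) (ι : ℕ → Fin n) (K : ℕ) : ℝ :=
  ∑ k ∈ Finset.Ico 1 K, stepError P γ y0 (lam n k) (iterates P γ x0 y0 ι k) (ι k)

/-- The accumulated error before iteration `K`, including the price of the supremum over the dual
points of comparison. -/
def pathPotential (P : Problem n d) (γ : ℝ) (x0 : EuclideanSpace ℝ (Fin d))
    (y0 : EuclideanSpace ℝ (Fin n)) (ι : ℕ → Fin n) (K : ℕ) : ℝ :=
  pathError P γ x0 y0 ι K + noisePotential P γ (pathNoise P γ x0 y0 ι K)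

/-- The primal point was computed with `y0`, the dual one with `x1`, which leaves the coupling error
`⟨A(x - x1), y0 - y1⟩`. It is paid by the proximal terms and by one further `nM/2 ‖x - x0‖²`, which
explains the doubled coefficient of `‖x - x0‖²`. -/
theorem initStep_le (hn : 2 ≤ n) (hP : P.Standing) (hA : ∀ i, P.A i ≠ 0) (hγ : 0 < γ) (hγ1 : γ < 1)
    (x0 : EuclideanSpace ℝ (Fin d)) (y0 : EuclideanSpace ℝ (Fin n)) {x : EuclideanSpace ℝ (Fin d)}
    (hx : P.g x ≠ ⊤) {y : EuclideanSpace ℝ (Fin n)} (hy : P.hstar y ≠ ⊤) :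
    (P.g (initStep P (tau P) (sigmaInit P γ) x0 y0).xbar).toReal - (P.g x).toReal
      + ∑ j, (P.mulA (initStep P (tau P) (sigmaInit P γ) x0 y0).xbar j * y j - (P.h j (y j)).toReal)
      + dualObj P x (initStep P (tau P) (sigmaInit P γ) x0 y0).y ≤
    n * P.maxRowNorm * ‖x - x0‖ ^ 2 + n * P.maxRowNorm / (2 * γ) * ‖y - y0‖ ^ 2
      - 1 / (2 * tau P) * ‖x - (initStep P (tau P) (sigmaInit P γ) x0 y0).x‖ ^ 2
      - n * P.maxRowNorm / (2 * γ) * ‖y - (initStep P (tau P) (sigmaInit P γ) x0 y0).y‖ ^ 2 := by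
  obtain ⟨a, b, hab⟩ := hP.g_minorant
  obtain ⟨a', b', hab'⟩ := hP.hstar_minorant
  have hτ := tau_pos (P := P) hn hA
  have hσ := sigmaInit_pos (P := P) hn hA hγ
  have hM := P.maxRowNorm_pos hn hA
  have hn2 : (2 : ℝ) ≤ n := by exact_mod_cast hn
  have h1 := (prox_spec hP.g_pcl hab hτ (x0 - tau P • P.mulAT y0)).2 x hx
  set x1 := prox (tau P) P.g (x0 - tau P • P.mulAT y0) with hx1
  obtain ⟨hy1, h2⟩ := prox_spec hP.hstar_pcl hab' hσ (y0 + sigmaInit P γ • P.mulA x1)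
  replace h2 := h2 y hy
  set y1 := prox (sigmaInit P γ) P.hstar (y0 + sigmaInit P γ • P.mulA x1) with hy1def
  have e1 : (initStep P (tau P) (sigmaInit P γ) x0 y0).xbar = x1 := rfl
  have e2 : (initStep P (tau P) (sigmaInit P γ) x0 y0).x = x1 := rfl
  have e3 : (initStep P (tau P) (sigmaInit P γ) x0 y0).y = y1 := rfl
  rw [e1, e2, e3]
  have e4 : x1 - (x0 - tau P • P.mulAT y0) = (x1 - x0) + tau P • P.mulAT y0 := by abel
  have e5 : y1 - (y0 + sigmaInit P γ • P.mulA x1) = (y1 - y0) - sigmaInit P γ • P.mulA x1 := by abel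
  rw [e4, inner_add_left, inner_smul_left, real_inner_comm _ (P.mulAT y0), ← P.inner_mulA] at h1
  rw [e5, inner_sub_left, inner_smul_left] at h2
  simp only [conj_trivial] at h1 h2
  have e6 : ‖x - x0‖ ^ 2 = ‖x - x1‖ ^ 2 + 2 * inner ℝ (x1 - x0) (x - x1) + ‖x1 - x0‖ ^ 2 := by
    have : x - x0 = (x - x1) + (x1 - x0) := by abel
    rw [this, norm_add_sq_real, real_inner_comm]
  have e7 : ‖y - y0‖ ^ 2 = ‖y - y1‖ ^ 2 + 2 * inner ℝ (y1 - y0) (y - y1) + ‖y1 - y0‖ ^ 2 := by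
    have : y - y0 = (y - y1) + (y1 - y0) := by abel
    rw [this, norm_add_sq_real, real_inner_comm]
  have e8 : ∑ j, (P.mulA x1 j * y j - (P.h j (y j)).toReal) =
      inner ℝ (P.mulA x1) y - (P.hstar y).toReal := by
    rw [Finset.sum_sub_distrib, P.inner_mulA_eq_sum, hP.hstar_toReal hy]
  have e9 : dualObj P x y1 = (P.hstar y1).toReal - inner ℝ (P.mulA x) y1 := by
    rw [dualObj, Finset.sum_sub_distrib, P.inner_mulA_eq_sum, hP.hstar_toReal hy1]
  rw [e8, e9]
  have b1 := P.inner_mulA_le (x - x0) (y0 - y1)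
  have b2 := P.inner_mulA_le (x0 - x1) (y0 - y1)
  -- Splitting `x - x1` at `x0` leaves one part charged to `‖x - x0‖²` and one absorbed by the
  -- primal term `‖x1 - x0‖²`.
  have e10 : inner ℝ (P.mulA (x - x0)) (y0 - y1) + inner ℝ (P.mulA (x0 - x1)) (y0 - y1) =
      inner ℝ (P.mulA (x - x1)) y0 - inner ℝ (P.mulA x) y1 + inner ℝ (P.mulA x1) y1 := by
    rw [← inner_add_left, ← P.mulA_add, sub_add_sub_cancel, inner_sub_right, P.mulA_sub,
      inner_sub_left _ _ y1]
    ring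
  rw [norm_sub_rev y0 y1] at b1 b2
  rw [norm_sub_rev x0 x1] at b2
  have t1 : 1 / tau P = n * P.maxRowNorm := by rw [tau, one_div_one_div]
  have t2 : 1 / (2 * tau P) = n * P.maxRowNorm / 2 := by rw [← t1]; field_simp
  have t3 : 1 / sigmaInit P γ = n * P.maxRowNorm / γ := by rw [sigmaInit, one_div_div]
  have h3 : 1 / tau P * (inner ℝ (x1 - x0) (x - x1) + tau P * inner ℝ (P.mulA (x - x1)) y0) =
      n * P.maxRowNorm * inner ℝ (x1 - x0) (x - x1) + inner ℝ (P.mulA (x - x1)) y0 := by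
    rw [← t1]; field_simp
  have h4 : 1 / sigmaInit P γ *
      (inner ℝ (y1 - y0) (y - y1) - sigmaInit P γ * inner ℝ (P.mulA x1) (y - y1)) =
      n * P.maxRowNorm / γ * inner ℝ (y1 - y0) (y - y1) - inner ℝ (P.mulA x1) y
        + inner ℝ (P.mulA x1) y1 := by
    rw [← t3, inner_sub_right (P.mulA x1)]; field_simp; ring
  rw [h3] at h1
  rw [h4] at h2
  -- The two coupling estimates together cost `M ‖y1 - y0‖²`, which the dual proximal term covers
  -- because `2γ ≤ n`.
  have h5 : P.maxRowNorm ≤ n * P.maxRowNorm / (2 * γ) := by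
    rw [le_div_iff₀ (by positivity)]
    nlinarith
  have h6 := mul_le_mul_of_nonneg_right h5 (sq_nonneg ‖y1 - y0‖)
  rw [t2]
  have h7 : n * P.maxRowNorm / (2 * γ) * ‖y - y0‖ ^ 2 = n * P.maxRowNorm / (2 * γ) * ‖y - y1‖ ^ 2
      + n * P.maxRowNorm / γ * inner ℝ (y1 - y0) (y - y1)
      + n * P.maxRowNorm / (2 * γ) * ‖y1 - y0‖ ^ 2 := by
    rw [e7]; field_simp
  have h8 : n * P.maxRowNorm * ‖x - x0‖ ^ 2 = n * P.maxRowNorm / 2 * ‖x - x0‖ ^ 2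
      + (n * P.maxRowNorm / 2 * ‖x - x1‖ ^ 2 + n * P.maxRowNorm * inner ℝ (x1 - x0) (x - x1)
      + n * P.maxRowNorm / 2 * ‖x1 - x0‖ ^ 2) := by
    rw [e6]; ring
  rw [h7, h8]
  linarith

theorem weighted_sq_le (hγ : 0 < γ) (v : EuclideanSpace ℝ (Fin n)) :
    ∑ j, P.rowNorm j / γ * v j ^ 2 ≤ P.maxRowNorm / γ * ‖v‖ ^ 2 := by
  rw [EuclideanSpace.real_norm_sq_eq, Finset.mul_sum]
  gcongr with j
  exact P.rowNorm_le j

theorem path_le (hn : 2 ≤ n) (hP : P.Standing) (hA : ∀ i, P.A i ≠ 0) (hγ : 0 < γ) (hγ1 : γ < 1)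
    (x0 : EuclideanSpace ℝ (Fin d)) (y0 : EuclideanSpace ℝ (Fin n)) (ι : ℕ → Fin n)
    {x : EuclideanSpace ℝ (Fin d)} (hx : P.g x ≠ ⊤) {y : EuclideanSpace ℝ (Fin n)}
    (hy : P.hstar y ≠ ⊤) (m : ℕ) :
    ∑ k ∈ Finset.range (m + 1), lam n k *
        ((P.g (iterates P γ x0 y0 ι (k + 1)).xbar).toReal - (P.g x).toReal
          + ∑ j, (P.mulA (iterates P γ x0 y0 ι (k + 1)).xbar j * y j - (P.h j (y j)).toReal))
      + (dualObj P x (iterates P γ x0 y0 ι 1).y + ∑ k ∈ Finset.Ico 1 (m + 1), lam n k *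
        (n * dualObj P x (iterates P γ x0 y0 ι (k + 1)).y
          - (n - 1) * dualObj P x (iterates P γ x0 y0 ι k).y)) ≤
    n * P.maxRowNorm * ‖x - x0‖ ^ 2 + n * P.maxRowNorm / (2 * γ) * ‖y - y0‖ ^ 2
      - 1 / (2 * tau P) * ‖x - (iterates P γ x0 y0 ι (m + 1)).x‖ ^ 2
      - n / 2 * ∑ j, P.rowNorm j / γ * (y j - (iterates P γ x0 y0 ι (m + 1)).y j) ^ 2
      + ∑ j, (y j - y0 j) * pathNoise P γ x0 y0 ι (m + 1) j + pathError P γ x0 y0 ι (m + 1) := by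
  induction m with
  | zero =>
    have h := initStep_le hn hP hA hγ hγ1 x0 y0 hx hy
    -- The first step has the uniform dual metric `nM/γ`, which dominates the metric `n ‖A_j‖/γ` of
    -- the random steps, so the distances still telescope.
    have h2 := weighted_sq_le (P := P) hγ (y - (initStep P (tau P) (sigmaInit P γ) x0 y0).y)
    have hn0 : (0 : ℝ) ≤ n / 2 := by positivity
    have h3 := mul_le_mul_of_nonneg_left h2 hn0
    have e : iterates P γ x0 y0 ι (0 + 1) = initStep P (tau P) (sigmaInit P γ) x0 y0 := rfl
    simp only [zero_add, Finset.range_one, Finset.sum_singleton, lam, one_mul,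
      Finset.Ico_self, Finset.sum_empty, add_zero, pathNoise, pathError, mul_zero,
      Finset.sum_const_zero] at e ⊢
    rw [e]
    have h4 : (n : ℝ) / 2 * (P.maxRowNorm / γ *
        ‖y - (initStep P (tau P) (sigmaInit P γ) x0 y0).y‖ ^ 2) = n * P.maxRowNorm / (2 * γ) *
        ‖y - (initStep P (tau P) (sigmaInit P γ) x0 y0).y‖ ^ 2 := by
      field_simp
    rw [h4] at h3
    simp only [PiLp.sub_apply] at h3
    linarith
  | succ m ih =>
    have h := step_le hn hP hA hγ (lam_pos hn (m + 1)) y0 (iterates P γ x0 y0 ι (m + 1))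
      (ι (m + 1)) hx hy
    rw [← iterates_add_two] at h
    have e1 : primalProx P (lam n (m + 1)) (iterates P γ x0 y0 ι (m + 1)) =
      (iterates P γ x0 y0 ι (m + 2)).xbar := rfl
    rw [e1] at h
    have e2 : ∀ j, pathNoise P γ x0 y0 ι (m + 1 + 1) j = pathNoise P γ x0 y0 ι (m + 1) j +
        stepNoise P γ (lam n (m + 1)) (iterates P γ x0 y0 ι (m + 1)) (ι (m + 1)) j := fun j =>
      Finset.sum_Ico_succ_top (by omega) _
    have e3 : pathError P γ x0 y0 ι (m + 1 + 1) = pathError P γ x0 y0 ι (m + 1) +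
        stepError P γ y0 (lam n (m + 1)) (iterates P γ x0 y0 ι (m + 1)) (ι (m + 1)) :=
      Finset.sum_Ico_succ_top (by omega) _
    have e4 : ∑ j, (y j - y0 j) * pathNoise P γ x0 y0 ι (m + 1 + 1) j =
        ∑ j, (y j - y0 j) * pathNoise P γ x0 y0 ι (m + 1) j + ∑ j, (y j - y0 j) *
          stepNoise P γ (lam n (m + 1)) (iterates P γ x0 y0 ι (m + 1)) (ι (m + 1)) j := by
      simp only [e2, mul_add, Finset.sum_add_distrib]
    rw [Finset.sum_range_succ, Finset.sum_Ico_succ_top (by omega), e3, e4]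
    linarith

/-! ### The averages -/

/-- The term with index 1 has coefficient `1 - (n-1) λ_1 = 0`. The identity is also used for `f =
1`, where it gives the total dual weight, and in the implementation, where it identifies the running
sum. -/
theorem dual_summation_by_parts (hn : 2 ≤ n) (f : ℕ → ℝ) (m : ℕ) :
    f 1 + ∑ k ∈ Finset.Ico 1 (m + 2), lam n k * (n * f (k + 1) - (n - 1) * f k) =
      n * lam n (m + 1) * f (m + 2)
        + ∑ k ∈ Finset.Ico 1 (m + 1), (n * lam n k - (n - 1) * lam n (k + 1)) * f (k + 1) := by
  induction m with
  | zero =>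
    simp only [zero_add, Nat.Ico_succ_singleton, Finset.sum_singleton, Finset.Ico_self,
      Finset.sum_empty]
    linear_combination -f 1 * mul_lam_one hn
  | succ m ih =>
    rw [Finset.sum_Ico_succ_top (by omega), ← add_assoc, ih,
      Finset.sum_Ico_succ_top (by omega : 1 ≤ m + 1)]
    ring

theorem Lam_eq_sum_dual (hn : 2 ≤ n) (m : ℕ) : Lam n (m + 2) = n * lam n (m + 1)
    + ∑ k ∈ Finset.Ico 1 (m + 1), (n * lam n k - (n - 1) * lam n (k + 1)) := by
  have h := dual_summation_by_parts hn (fun _ => 1) m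
  simp only [mul_one] at h
  rw [← h, Lam, Finset.range_eq_Ico, Finset.sum_eq_sum_Ico_succ_bot (by omega)]
  simp [lam]

/-- The weight of the dual iterate with index `k + 1` in the average with `m + 2` iterations. -/
def dualWeight (n m k : ℕ) : ℝ :=
  if k = m + 1 then n * lam n k else n * lam n k - (n - 1) * lam n (k + 1)

theorem sum_dualWeight {E : Type*} [AddCommGroup E] [Module ℝ E] (m : ℕ) (f : ℕ → E) :
    ∑ k ∈ Finset.Ico 1 (m + 2), dualWeight n m k • f k = (n * lam n (m + 1)) • f (m + 1)
      + ∑ k ∈ Finset.Ico 1 (m + 1), ((n : ℝ) * lam n k - (n - 1) * lam n (k + 1)) • f k := by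
  rw [Finset.sum_Ico_succ_top (by omega), add_comm]
  congr 1
  · simp [dualWeight]
  · refine Finset.sum_congr rfl fun k hk => ?_
    rw [Finset.mem_Ico] at hk
    rw [dualWeight, if_neg (by omega)]

theorem dualWeight_nonneg (hn : 2 ≤ n) (m : ℕ) : ∀ k ∈ Finset.Ico 1 (m + 2),
    0 ≤ dualWeight n m k := by
  intro k hk
  rw [Finset.mem_Ico] at hk
  obtain ⟨k, rfl⟩ := Nat.exists_eq_add_of_le' hk.1
  rw [dualWeight]
  split_ifs
  · exact mul_nonneg (Nat.cast_nonneg _) (lam_pos hn _).le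
  · exact sub_nonneg.2 (mul_lam_succ_le hn k)

theorem sum_dualWeight_eq_Lam (hn : 2 ≤ n) (m : ℕ) :
    ∑ k ∈ Finset.Ico 1 (m + 2), dualWeight n m k = Lam n (m + 2) := by
  have h := sum_dualWeight (n := n) m (fun _ => (1 : ℝ))
  simp only [smul_eq_mul, mul_one] at h
  rw [h, Lam_eq_sum_dual hn]

theorem xAvg_eq_centerMass (P : Problem n d) (γ : ℝ) (x0 : EuclideanSpace ℝ (Fin d))
    (y0 : EuclideanSpace ℝ (Fin n)) (ι : ℕ → Fin n) (K : ℕ) :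
    xAvg P γ x0 y0 ι K = (Finset.range K).centerMass (lam n)
      fun k => (iterates P γ x0 y0 ι (k + 1)).xbar := by
  rw [xAvg, Finset.centerMass, one_div, Lam]

theorem yAvg_eq_centerMass (hn : 2 ≤ n) (P : Problem n d) (γ : ℝ) (x0 : EuclideanSpace ℝ (Fin d))
    (y0 : EuclideanSpace ℝ (Fin n)) (ι : ℕ → Fin n) (m : ℕ) :
    yAvg P γ x0 y0 ι (m + 2) = (Finset.Ico 1 (m + 2)).centerMass (dualWeight n m)
      fun k => (iterates P γ x0 y0 ι (k + 1)).y := by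
  rw [yAvg, Finset.centerMass, one_div, sum_dualWeight_eq_Lam hn, sum_dualWeight]
  rfl

theorem sum_mul_le_of_convexOn {E κ : Type*} [AddCommGroup E] [Module ℝ E] {s : Set E} {f : E → ℝ}
    (hf : ConvexOn ℝ s f) {t : Finset κ} {w : κ → ℝ} {p : κ → E} (hw : ∀ k ∈ t, 0 ≤ w k)
    (hW : 0 < ∑ k ∈ t, w k) (hp : ∀ k ∈ t, p k ∈ s) :
    (∑ k ∈ t, w k) * f (t.centerMass w p) ≤ ∑ k ∈ t, w k * f (p k) := by
  have h := mul_le_mul_of_nonneg_left (hf.map_centerMass_le hw hW hp) hW.le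
  refine h.trans_eq ?_
  simp only [Finset.centerMass, Function.comp_def, smul_eq_mul]
  field_simp

theorem convexOn_dualObj (hP : P.Standing) (x : EuclideanSpace ℝ (Fin d)) :
    ConvexOn ℝ {y | P.hstar y ≠ ⊤} (dualObj P x) := by
  have hc := hP.hstar_pcl.convexOn_toReal.1
  refine ⟨hc, fun u hu v hv a b ha hb hab => ?_⟩
  have hu' := (hP.hstar_ne_top_iff u).1 hu
  have hv' := (hP.hstar_ne_top_iff v).1 hv
  simp only [dualObj, Finset.smul_sum, ← Finset.sum_add_distrib]
  refine Finset.sum_le_sum fun j _ => ?_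
  have h := (hP.h_pcl j).convexOn_toReal.2 (hu' j) (hv' j) ha hb hab
  simp only [PiLp.add_apply, PiLp.smul_apply, smul_eq_mul] at h ⊢
  nlinarith

theorem convexOn_primalObj (hP : P.Standing) (y : EuclideanSpace ℝ (Fin n)) :
    ConvexOn ℝ {x | P.g x ≠ ⊤} fun x => (P.g x).toReal + ∑ j, P.mulA x j * y j := by
  have hc := hP.g_pcl.convexOn_toReal
  refine ⟨hc.1, fun u hu v hv a b ha hb hab => ?_⟩
  have h := hc.2 hu hv ha hb hab
  have e : ∑ j, P.mulA (a • u + b • v) j * y j =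
      a * ∑ j, P.mulA u j * y j + b * ∑ j, P.mulA v j * y j := by
    simp only [P.mulA_add, P.mulA_smul, Finset.mul_sum, ← Finset.sum_add_distrib]
    refine Finset.sum_congr rfl fun j _ => ?_
    simp; ring
  simp only [smul_eq_mul] at h ⊢
  rw [e]
  linarith

theorem xAvg_mem_dom (hn : 2 ≤ n) (hP : P.Standing) (hA : ∀ i, P.A i ≠ 0) (hγ : 0 < γ)
    (x0 : EuclideanSpace ℝ (Fin d)) (y0 : EuclideanSpace ℝ (Fin n)) (ι : ℕ → Fin n) {K : ℕ}
    (hK : 1 ≤ K) : P.g (xAvg P γ x0 y0 ι K) ≠ ⊤ := by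
  rw [xAvg_eq_centerMass]
  exact hP.g_pcl.convexOn_toReal.1.centerMass_mem (fun k _ => (lam_pos hn k).le) (Lam_pos hn hK)
    fun k _ => (iterates_mem_dom hn hP hA hγ x0 y0 ι k).1

theorem yAvg_mem_dom (hn : 2 ≤ n) (hP : P.Standing) (hA : ∀ i, P.A i ≠ 0) (hγ : 0 < γ)
    (x0 : EuclideanSpace ℝ (Fin d)) (y0 : EuclideanSpace ℝ (Fin n)) (ι : ℕ → Fin n) {K : ℕ}
    (hK : 2 ≤ K) : P.hstar (yAvg P γ x0 y0 ι K) ≠ ⊤ := by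
  obtain ⟨m, rfl⟩ := Nat.exists_eq_add_of_le' hK
  rw [yAvg_eq_centerMass hn]
  refine hP.hstar_pcl.convexOn_toReal.1.centerMass_mem (dualWeight_nonneg hn m) ?_
    fun k _ => (iterates_mem_dom hn hP hA hγ x0 y0 ι k).2
  rw [sum_dualWeight_eq_Lam hn]
  exact Lam_pos hn (by omega)

/-- Weighted Young inequality, with its parameter `(n-1)/(1-γ)` fixed by the coefficient that
`sum_potential_le` can afford. The right side handles all `v` with the same noise term, which
permits a maximum inside the expectation. -/
theorem sum_mul_noise_le (hn : 2 ≤ n) (hA : ∀ i, P.A i ≠ 0) (hγ : 0 < γ) (hγ1 : γ < 1)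
    (v : EuclideanSpace ℝ (Fin n)) (S : Fin n → ℝ) :
    ∑ j, v j * S j ≤ (n - 1) * P.maxRowNorm / (2 * γ * (1 - γ)) * ‖v‖ ^ 2
      + noisePotential P γ S := by
  have hN := natCast_sub_one_ge_one hn
  have h1γ : 0 < 1 - γ := by linarith
  have h : ∀ j, v j * S j ≤ (n - 1) / (2 * (1 - γ)) * (P.rowNorm j / γ * v j ^ 2)
      + (1 - γ) / (2 * ((n : ℝ) - 1)) * (S j ^ 2 / (P.rowNorm j / γ)) := by
    intro j
    have hR := P.rowNorm_pos hA j
    set w := P.rowNorm j / γ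
    have hw : 0 < w := by positivity
    set a := ((n : ℝ) - 1) / (1 - γ) with ha
    have ha0 : 0 < a := div_pos (by linarith) h1γ
    have e1 : ((n : ℝ) - 1) / (2 * (1 - γ)) = a / 2 := by rw [ha]; field_simp
    have e2 : (1 - γ) / (2 * ((n : ℝ) - 1)) = 1 / (2 * a) := by
      rw [ha]
      have : (n : ℝ) - 1 ≠ 0 := by linarith
      field_simp
    rw [e1, e2]
    have e3 : a / 2 * (w * v j ^ 2) + 1 / (2 * a) * (S j ^ 2 / w) - v j * S j =
        1 / (2 * a * w) * (a * w * v j - S j) ^ 2 := by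
      field_simp
      ring
    have : 0 ≤ 1 / (2 * a * w) * (a * w * v j - S j) ^ 2 := by positivity
    linarith
  refine (Finset.sum_le_sum fun j _ => h j).trans ?_
  rw [Finset.sum_add_distrib, ← Finset.mul_sum, ← Finset.mul_sum, noisePotential]
  have h2 := mul_le_mul_of_nonneg_left (weighted_sq_le (P := P) hγ v)
    (by positivity : 0 ≤ ((n : ℝ) - 1) / (2 * (1 - γ)))
  have e : ((n : ℝ) - 1) / (2 * (1 - γ)) * (P.maxRowNorm / γ * ‖v‖ ^ 2) =
      (n - 1) * P.maxRowNorm / (2 * γ * (1 - γ)) * ‖v‖ ^ 2 := by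
    field_simp
  linarith

theorem L_sub_L_avg_le (hn : 2 ≤ n) (hP : P.Standing) (hA : ∀ i, P.A i ≠ 0) (hγ : 0 < γ)
    (hγ1 : γ < 1) (x0 : EuclideanSpace ℝ (Fin d)) (y0 : EuclideanSpace ℝ (Fin n)) (ι : ℕ → Fin n)
    {K : ℕ} (hK : 2 ≤ K) {x : EuclideanSpace ℝ (Fin d)} (hx : P.g x ≠ ⊤)
    {y : EuclideanSpace ℝ (Fin n)} (hy : P.hstar y ≠ ⊤) :
    Lam n K * ((inner ℝ (P.mulA (xAvg P γ x0 y0 ι K)) y - (P.hstar y).toReal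
        + (P.g (xAvg P γ x0 y0 ι K)).toReal)
      - (inner ℝ (P.mulA x) (yAvg P γ x0 y0 ι K) - (P.hstar (yAvg P γ x0 y0 ι K)).toReal
        + (P.g x).toReal)) ≤
    n * P.maxRowNorm / (γ * (1 - γ)) * (‖x - x0‖ ^ 2 + ‖y - y0‖ ^ 2)
      + pathPotential P γ x0 y0 ι K := by
  have hyd := yAvg_mem_dom hn hP hA hγ x0 y0 ι hK
  obtain ⟨m, rfl⟩ := Nat.exists_eq_add_of_le' hK
  have hN := natCast_sub_one_ge_one hn
  have h1γ : 0 < 1 - γ := by linarith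
  have hM := P.maxRowNorm_pos hn hA
  have hpath := path_le hn hP hA hγ hγ1 x0 y0 ι hx hy (m + 1)
  rw [dual_summation_by_parts hn (fun k => dualObj P x (iterates P γ x0 y0 ι k).y) m] at hpath
  have hyoung := sum_mul_noise_le hn hA hγ hγ1 (y - y0) (pathNoise P γ x0 y0 ι (m + 2))
  have hprimal := sum_mul_le_of_convexOn (convexOn_primalObj hP y) (t := Finset.range (m + 2))
    (fun k _ => (lam_pos hn k).le) (Lam_pos hn (K := m + 2) (by omega))
    fun k _ => (iterates_mem_dom hn hP hA hγ x0 y0 ι k).1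
  rw [← xAvg_eq_centerMass] at hprimal
  have hdual := sum_mul_le_of_convexOn (convexOn_dualObj hP x) (dualWeight_nonneg hn m)
    ((sum_dualWeight_eq_Lam hn m).symm ▸ Lam_pos hn (by omega))
    fun k _ => (iterates_mem_dom hn hP hA hγ x0 y0 ι k).2
  rw [← yAvg_eq_centerMass hn, sum_dualWeight_eq_Lam hn] at hdual
  have hsd := sum_dualWeight (n := n) m fun k => dualObj P x (iterates P γ x0 y0 ι (k + 1)).y
  simp only [smul_eq_mul] at hsd
  rw [hsd] at hdual
  have e1 : dualObj P x (yAvg P γ x0 y0 ι (m + 2)) = (P.hstar (yAvg P γ x0 y0 ι (m + 2))).toReal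
      - inner ℝ (P.mulA x) (yAvg P γ x0 y0 ι (m + 2)) := by
    rw [dualObj, Finset.sum_sub_distrib, P.inner_mulA_eq_sum, hP.hstar_toReal hyd]
  have e2 : ∑ k ∈ Finset.range (m + 1 + 1), lam n k *
        ((P.g (iterates P γ x0 y0 ι (k + 1)).xbar).toReal - (P.g x).toReal
          + ∑ j, (P.mulA (iterates P γ x0 y0 ι (k + 1)).xbar j * y j - (P.h j (y j)).toReal)) =
      ∑ k ∈ Finset.range (m + 2), lam n k * ((P.g (iterates P γ x0 y0 ι (k + 1)).xbar).toReal
        + ∑ j, P.mulA (iterates P γ x0 y0 ι (k + 1)).xbar j * y j)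
      - Lam n (m + 2) * ((P.g x).toReal + (P.hstar y).toReal) := by
    rw [Lam, Finset.sum_mul, ← Finset.sum_sub_distrib, hP.hstar_toReal hy]
    refine Finset.sum_congr rfl fun k _ => ?_
    rw [Finset.sum_sub_distrib]
    ring
  rw [e2] at hpath
  rw [e1] at hdual
  change Lam n (m + 2) * _ ≤ _ at hprimal
  have hp1 : 0 ≤ 1 / (2 * tau P) * ‖x - (iterates P γ x0 y0 ι (m + 1 + 1)).x‖ ^ 2 := by
    have := tau_pos (P := P) hn hA
    positivity
  have hp2 : 0 ≤ (n : ℝ) / 2 *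
      ∑ j, P.rowNorm j / γ * (y j - (iterates P γ x0 y0 ι (m + 1 + 1)).y j) ^ 2 := by
    refine mul_nonneg (by positivity) (Finset.sum_nonneg fun j _ => ?_)
    have := P.rowNorm_pos hA j
    positivity
  have hcx : n * P.maxRowNorm ≤ n * P.maxRowNorm / (γ * (1 - γ)) := by
    rw [le_div_iff₀ (by positivity)]
    have : γ * (1 - γ) ≤ 1 := by nlinarith
    exact mul_le_of_le_one_right (by positivity) this
  -- The two shares of `‖y - y0‖²` come from the first step and from Young's inequality for the
  -- noise.
  have hcy : n * P.maxRowNorm / (2 * γ) + (n - 1) * P.maxRowNorm / (2 * γ * (1 - γ)) ≤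
      n * P.maxRowNorm / (γ * (1 - γ)) := by
    have e : n * P.maxRowNorm / (γ * (1 - γ))
        - (n * P.maxRowNorm / (2 * γ) + (n - 1) * P.maxRowNorm / (2 * γ * (1 - γ))) =
        P.maxRowNorm * (n * γ + 1) / (2 * γ * (1 - γ)) := by
      field_simp
      ring
    have : 0 ≤ P.maxRowNorm * (n * γ + 1) / (2 * γ * (1 - γ)) := by positivity
    linarith
  have hcx' := mul_le_mul_of_nonneg_right hcx (sq_nonneg ‖x - x0‖)
  have hcy' := mul_le_mul_of_nonneg_right hcy (sq_nonneg ‖y - y0‖)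
  rw [pathPotential, P.inner_mulA_eq_sum (xAvg P γ x0 y0 ι (m + 2))]
  simp only [PiLp.sub_apply] at hyoung
  have e3 : m + 1 + 1 = m + 2 := rfl
  rw [e3] at hpath hp1 hp2
  linarith

end Path

/-! ### The duality gap -/

section Gap

variable {P : Problem n d} {x' : EuclideanSpace ℝ (Fin d)} {y' : EuclideanSpace ℝ (Fin n)}

/-- As the negative of a sum with no summand `⊥`, the gap function avoids undefined differences of
infinities and its upper semicontinuity becomes visible. -/
theorem G_eq_neg (hP : P.Standing) (hx' : P.g x' ≠ ⊤) (hy' : P.hstar y' ≠ ⊤)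
    (z : EuclideanSpace ℝ (Fin d) × EuclideanSpace ℝ (Fin n)) :
    P.G x' y' z = -(P.hstar z.2 + P.g z.1 + ((inner ℝ (P.mulA z.1) y' - (P.hstar y').toReal
      - inner ℝ (P.mulA x') z.2 - (P.g x').toReal : ℝ) : EReal)) := by
  rw [Problem.G]
  by_cases h2 : P.hstar z.2 = ⊤
  · rw [Problem.Standing.L_eq_bot h2, h2, EReal.top_add_of_ne_bot (hP.g_pcl.ne_bot _),
      EReal.top_add_coe, EReal.neg_top, sub_eq_add_neg, EReal.bot_add]
  by_cases h1 : P.g z.1 = ⊤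
  · rw [hP.L_eq_top h1 hy', h1, EReal.add_top_of_ne_bot (hP.hstar_ne_bot _), EReal.top_add_coe,
      EReal.neg_top, sub_eq_add_neg, EReal.neg_top, EReal.add_bot]
  · rw [hP.L_eq_coe hx' h2, hP.L_eq_coe h1 hy', ← EReal.coe_toReal h2 (hP.hstar_ne_bot _),
      ← EReal.coe_toReal h1 (hP.g_pcl.ne_bot _), ← EReal.coe_sub, ← EReal.coe_add, ← EReal.coe_add,
      ← EReal.coe_neg]
    simp only [EReal.toReal_coe]
    congr 1
    ring

theorem gap_attained (hP : P.Standing) (hx' : P.g x' ≠ ⊤) (hy' : P.hstar y' ≠ ⊤)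
    {Z : Set (EuclideanSpace ℝ (Fin d) × EuclideanSpace ℝ (Fin n))} (hZ : Z.Nonempty)
    (hZc : IsCompact Z) : P.gap Z x' y' ≠ ⊤ ∧ ∃ z ∈ Z, P.gap Z x' y' = P.G x' y' z := by
  have hb : ∀ z : EuclideanSpace ℝ (Fin d) × EuclideanSpace ℝ (Fin n),
      P.hstar z.2 + P.g z.1 ≠ ⊥ := fun z =>
    EReal.add_ne_bot_iff.2 ⟨hP.hstar_ne_bot _, hP.g_pcl.ne_bot _⟩
  have hA : Continuous P.mulA := by
    have : P.mulA = fun x => WithLp.toLp 2 fun i => inner ℝ (P.row i) x := by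
      ext x i; simp [P.mulA_apply]
    rw [this]
    fun_prop
  have hlsc : LowerSemicontinuous fun z : EuclideanSpace ℝ (Fin d) × EuclideanSpace ℝ (Fin n) =>
      P.hstar z.2 + P.g z.1 + ((inner ℝ (P.mulA z.1) y' - (P.hstar y').toReal
      - inner ℝ (P.mulA x') z.2 - (P.g x').toReal : ℝ) : EReal) :=
    lowerSemicontinuous_ereal_add
      (lowerSemicontinuous_ereal_add (hP.hstar_pcl.lsc.comp continuous_snd)
        (hP.g_pcl.lsc.comp continuous_fst) (fun _ => hP.hstar_ne_bot _)
        fun _ => hP.g_pcl.ne_bot _)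
      (Continuous.lowerSemicontinuous (continuous_coe_real_ereal.comp (by fun_prop)))
      hb fun _ => EReal.coe_ne_bot _
  obtain ⟨z, hz, hmin⟩ := LowerSemicontinuousOn.exists_isMinOn hZ hZc (hlsc.lowerSemicontinuousOn Z)
  have hgap : P.gap Z x' y' = P.G x' y' z := by
    refine le_antisymm (iSup₂_le fun w hw => ?_) (le_iSup₂ (f := fun z _ => P.G x' y' z) z hz)
    rw [G_eq_neg hP hx' hy', G_eq_neg hP hx' hy', EReal.neg_le_neg_iff]
    exact hmin hw
  refine ⟨?_, z, hz, hgap⟩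
  rw [hgap, G_eq_neg hP hx' hy', Ne, EReal.neg_eq_top_iff, ← Ne, EReal.add_ne_bot_iff]
  exact ⟨hb z, EReal.coe_ne_bot _⟩

theorem sq_dist_le_DZ (x0 : EuclideanSpace ℝ (Fin d)) (y0 : EuclideanSpace ℝ (Fin n))
    {Z : Set (EuclideanSpace ℝ (Fin d) × EuclideanSpace ℝ (Fin n))} (hZc : IsCompact Z)
    {z : EuclideanSpace ℝ (Fin d) × EuclideanSpace ℝ (Fin n)} (hz : z ∈ Z) :
    ‖z.1 - x0‖ ^ 2 + ‖z.2 - y0‖ ^ 2 ≤ DZ x0 y0 Z :=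
  le_csSup (hZc.image_of_continuousOn (by fun_prop)).bddAbove ⟨z, hz, rfl⟩

theorem DZ_nonneg (x0 : EuclideanSpace ℝ (Fin d)) (y0 : EuclideanSpace ℝ (Fin n))
    {Z : Set (EuclideanSpace ℝ (Fin d) × EuclideanSpace ℝ (Fin n))} (hZ : Z.Nonempty)
    (hZc : IsCompact Z) : 0 ≤ DZ x0 y0 Z := by
  obtain ⟨z, hz⟩ := hZ
  exact le_trans (by positivity) (sq_dist_le_DZ x0 y0 hZc hz)

/-- Holds along every path of indices; only the expectation of `pathPotential` remains to be
controlled. Comparison points outside the domains contribute `⊥`. -/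
theorem gap_avg_le {γ : ℝ} (hn : 2 ≤ n) (hP : P.Standing) (hA : ∀ i, P.A i ≠ 0) (hγ : 0 < γ)
    (hγ1 : γ < 1) (x0 : EuclideanSpace ℝ (Fin d)) (y0 : EuclideanSpace ℝ (Fin n)) (ι : ℕ → Fin n)
    {Z : Set (EuclideanSpace ℝ (Fin d) × EuclideanSpace ℝ (Fin n))} (hZc : IsCompact Z)
    {K : ℕ} (hK : 2 ≤ K) :
    P.gap Z (xAvg P γ x0 y0 ι K) (yAvg P γ x0 y0 ι K) ≤
      (((n * P.maxRowNorm / (γ * (1 - γ)) * DZ x0 y0 Z + pathPotential P γ x0 y0 ι K) / Lam n K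
        : ℝ) : EReal) := by
  have hxd := xAvg_mem_dom hn hP hA hγ x0 y0 ι (by omega : 1 ≤ K)
  have hyd := yAvg_mem_dom hn hP hA hγ x0 y0 ι hK
  refine iSup₂_le fun z hz => ?_
  rw [Problem.G]
  by_cases h2 : P.hstar z.2 = ⊤
  · rw [Problem.Standing.L_eq_bot h2, sub_eq_add_neg, EReal.bot_add]
    exact bot_le
  by_cases h1 : P.g z.1 = ⊤
  · rw [hP.L_eq_top h1 hyd, sub_eq_add_neg, EReal.neg_top, EReal.add_bot]
    exact bot_le
  rw [hP.L_eq_coe hxd h2, hP.L_eq_coe h1 hyd, ← EReal.coe_sub, EReal.coe_le_coe_iff,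
    le_div_iff₀ (Lam_pos hn (by omega)), mul_comm]
  refine (L_sub_L_avg_le hn hP hA hγ hγ1 x0 y0 ι hK h1 h2).trans ?_
  have hM := P.maxRowNorm_pos hn hA
  have h1γ : 0 < 1 - γ := by linarith
  have := sq_dist_le_DZ x0 y0 hZc hz
  gcongr

end Gap

/-! ### Dependence on the picked coordinates -/

section Dependence

variable {P : Problem n d} {γ : ℝ} {x0 : EuclideanSpace ℝ (Fin d)} {y0 : EuclideanSpace ℝ (Fin n)}
  {ι ι' : ℕ → Fin n}

theorem iterates_congr {K : ℕ} (h : ∀ k < K, ι k = ι' k) :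
    iterates P γ x0 y0 ι K = iterates P γ x0 y0 ι' K := by
  induction K with
  | zero => rfl
  | succ K ih =>
    cases K with
    | zero => rfl
    | succ K => rw [iterates_add_two, iterates_add_two, ih fun k hk => h k (by omega),
        h (K + 1) (by omega)]

theorem pathNoise_congr {K : ℕ} (h : ∀ k < K, ι k = ι' k) :
    pathNoise P γ x0 y0 ι K = pathNoise P γ x0 y0 ι' K := by
  ext j
  refine Finset.sum_congr rfl fun k hk => ?_
  have hk' := (Finset.mem_Ico.1 hk).2
  rw [iterates_congr fun l hl => h l (by omega), h k hk']

theorem pathError_congr {K : ℕ} (h : ∀ k < K, ι k = ι' k) :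
    pathError P γ x0 y0 ι K = pathError P γ x0 y0 ι' K := by
  refine Finset.sum_congr rfl fun k hk => ?_
  have hk' := (Finset.mem_Ico.1 hk).2
  rw [iterates_congr fun l hl => h l (by omega), h k hk']

theorem xAvg_congr {K : ℕ} (h : ∀ k < K, ι k = ι' k) :
    xAvg P γ x0 y0 ι K = xAvg P γ x0 y0 ι' K := by
  unfold xAvg
  congr 1
  refine Finset.sum_congr rfl fun k hk => ?_
  have hk' := Finset.mem_range.1 hk
  rw [iterates_congr fun l hl => h l (by omega)]

theorem yAvg_congr {K : ℕ} (h : ∀ k < K, ι k = ι' k) :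
    yAvg P γ x0 y0 ι K = yAvg P γ x0 y0 ι' K := by
  unfold yAvg
  rw [iterates_congr h]
  congr 2
  refine Finset.sum_congr rfl fun k hk => ?_
  have hk' := (Finset.mem_Ico.1 hk).2
  rw [iterates_congr fun l hl => h l (by omega)]

/-- The supermartingale property stated path by path: the past is fixed and only the index of
iteration `k` is averaged. -/
theorem sum_pathPotential_update_le (hn : 2 ≤ n) (hA : ∀ i, P.A i ≠ 0) (hγ : 0 < γ) {k : ℕ}
    (hk : 1 ≤ k) :
    ∑ i, pathPotential P γ x0 y0 (Function.update ι k i) (k + 1) ≤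
      n * pathPotential P γ x0 y0 ι k := by
  have h : ∀ i, ∀ l < k, Function.update ι k i l = ι l := fun i l hl =>
    Function.update_of_ne (by omega) _ _
  refine le_trans (Finset.sum_le_sum fun i _ => le_of_eq ?_) (sum_potential_le hn hA hγ
    (lam_pos hn k) (lam_le_one hn k) y0 (iterates P γ x0 y0 ι k) (pathNoise P γ x0 y0 ι k)
    (pathError P γ x0 y0 ι k))
  have e1 : pathNoise P γ x0 y0 (Function.update ι k i) (k + 1) = fun j =>
      pathNoise P γ x0 y0 ι k j + stepNoise P γ (lam n k) (iterates P γ x0 y0 ι k) i j := by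
    ext j
    rw [← pathNoise_congr (h i), ← iterates_congr (h i), pathNoise, Finset.sum_Ico_succ_top hk,
      Function.update_self, pathNoise]
  have e2 : pathError P γ x0 y0 (Function.update ι k i) (k + 1) = pathError P γ x0 y0 ι k
      + stepError P γ y0 (lam n k) (iterates P γ x0 y0 ι k) i := by
    rw [← pathError_congr (h i), ← iterates_congr (h i), pathError, Finset.sum_Ico_succ_top hk,
      Function.update_self, pathError]
  rw [pathPotential, e1, e2]

end Dependence

/-! ### Expectations -/

section Expectation

variable {Ω : Type*} [MeasurableSpace Ω] {μ : Measure Ω} {ι : ℕ → Ω → Fin n}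

/-- Factoring through a finite type makes every such functional measurable and bounded, so no
regularity of the proximal maps in the data is needed. -/
theorem exists_comp_restrict {β : Type*} (i0 : Fin n) {K : ℕ} {f : (ℕ → Fin n) → β}
    (hf : DependsOn f (Set.Iio K)) :
    ∃ G : (Finset.range K → Fin n) → β, ∀ s, f s = G fun k => s k := by
  refine ⟨fun r => f fun m => if h : m ∈ Finset.range K then r ⟨m, h⟩ else i0, fun s => ?_⟩
  refine hf fun k hk => ?_
  rw [dif_pos (Finset.mem_range.2 hk)]

theorem measurable_of_dependsOn {β : Type*} [MeasurableSpace β] (i0 : Fin n)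
    (hι : ∀ k, Measurable (ι k)) {K : ℕ} {f : (ℕ → Fin n) → β} (hf : DependsOn f (Set.Iio K)) :
    Measurable fun ω => f fun k => ι k ω := by
  obtain ⟨G, hG⟩ := exists_comp_restrict i0 hf
  simp only [hG]
  exact (measurable_of_finite G).comp (measurable_pi_lambda _ fun k => hι k)

theorem integrable_of_dependsOn [IsProbabilityMeasure μ] (i0 : Fin n)
    (hι : ∀ k, Measurable (ι k)) {K : ℕ} {f : (ℕ → Fin n) → ℝ} (hf : DependsOn f (Set.Iio K)) :
    Integrable (fun ω => f fun k => ι k ω) μ := by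
  obtain ⟨G, hG⟩ := exists_comp_restrict i0 hf
  simp only [hG]
  have hm : Measurable fun ω (k : Finset.range K) => ι k ω := measurable_pi_lambda _ fun k => hι k
  have := Measure.isProbabilityMeasure_map (μ := μ) hm.aemeasurable
  exact (Integrable.of_finite (f := G) (μ := μ.map fun ω (k : Finset.range K) => ι k ω)).comp_measurable
    hm

theorem dependsOn_update {β : Type*} {K : ℕ} {f : (ℕ → Fin n) → β}
    (hf : DependsOn f (Set.Iio (K + 1))) (j : Fin n) :
    DependsOn (fun s => f (Function.update s K j)) (Set.Iio K) := by
  intro s s' h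
  refine hf fun k hk => ?_
  by_cases hkK : k = K
  · subst hkK; simp
  · rw [Function.update_of_ne hkK, Function.update_of_ne hkK]
    have : k < K + 1 := hk
    exact h k (show k < K by omega)

/-- Conditioning on the past: split according to the value of index `K`, which is independent of the
earlier indices and uniform. -/
theorem integral_eq_average [IsProbabilityMeasure μ] (i0 : Fin n) (hι : ∀ k, Measurable (ι k))
    (hind : iIndepFun ι μ) (hunif : ∀ k i, μ (ι k ⁻¹' {i}) = (n : ℝ≥0∞)⁻¹) {K : ℕ}
    {f : (ℕ → Fin n) → ℝ} (hf : DependsOn f (Set.Iio (K + 1))) :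
    ∫ ω, f (fun k => ι k ω) ∂μ =
      ∫ ω, (n : ℝ)⁻¹ * ∑ j, f (Function.update (fun k => ι k ω) K j) ∂μ := by
  have hsplit : ∀ ω, f (fun k => ι k ω) = ∑ j, (ι K ⁻¹' {j}).indicator (fun _ => (1 : ℝ)) ω *
      f (Function.update (fun k => ι k ω) K j) := by
    intro ω
    rw [Finset.sum_eq_single (ι K ω)]
    · simp
    · intro j _ hj
      rw [Set.indicator_of_notMem (by simpa using hj.symm), zero_mul]
    · simp
  have hint : ∀ j, Integrable (fun ω => f (Function.update (fun k => ι k ω) K j)) μ := fun j =>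
    integrable_of_dependsOn i0 hι (dependsOn_update hf j)
  have hset : ∀ j, MeasurableSet (ι K ⁻¹' {j}) := fun j => hι K (measurableSet_singleton j)
  have hprod : ∀ j, ∫ ω, (ι K ⁻¹' {j}).indicator (fun _ => (1 : ℝ)) ω *
      f (Function.update (fun k => ι k ω) K j) ∂μ =
      (n : ℝ)⁻¹ * ∫ ω, f (Function.update (fun k => ι k ω) K j) ∂μ := by
    intro j
    obtain ⟨G, hG⟩ := exists_comp_restrict i0 (dependsOn_update hf j)
    have hi := hind.indepFun_finset {K} (Finset.range K) (by simp) hι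
    have hi2 := hi.comp (φ := fun r => ({j} : Set (Fin n)).indicator (fun _ => (1 : ℝ))
      (r ⟨K, by simp⟩)) (ψ := G) (measurable_of_finite _) (measurable_of_finite _)
    have hm : ∀ (T : Finset ℕ) (F : (T → Fin n) → ℝ),
        AEStronglyMeasurable (F ∘ fun ω (k : T) => ι k ω) μ := fun T F =>
      ((measurable_of_finite F).comp (measurable_pi_lambda _ fun k => hι k)).aestronglyMeasurable
    have h := hi2.integral_fun_mul_eq_mul_integral (hm _ _) (hm _ _)
    have e1 : ∫ ω, (ι K ⁻¹' {j}).indicator (fun _ => (1 : ℝ)) ω ∂μ = (n : ℝ)⁻¹ := by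
      rw [integral_indicator_const _ (hset j), Measure.real, hunif]
      simp
    simp only [hG]
    rw [← e1]
    exact h
  simp_rw [hsplit]
  rw [integral_finsetSum, integral_const_mul, integral_finsetSum, Finset.mul_sum]
  · exact Finset.sum_congr rfl fun j _ => hprod j
  · exact fun j _ => hint j
  · intro j _
    refine (Integrable.indicator (hint j) (hset j)).congr (Filter.Eventually.of_forall fun ω => ?_)
    by_cases h : ω ∈ ι K ⁻¹' {j}
    · simp only [Set.indicator_of_mem h, one_mul]
    · simp only [Set.indicator_of_notMem h, zero_mul]

/-- Positive and negative parts are compared separately, so `f` itself need not be measurable or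
integrable. -/
theorem expectation_le_of_le {f : Ω → EReal} {B : Ω → ℝ} (hB : Integrable B μ)
    (h : ∀ ω, f ω ≤ (B ω : EReal)) : expectation μ f ≤ ((∫ ω, B ω ∂μ : ℝ) : EReal) := by
  have hp : ∫⁻ ω, ENNReal.ofReal (B ω) ∂μ ≠ ⊤ := hB.lintegral_lt_top.ne
  have hm : ∫⁻ ω, ENNReal.ofReal (-B ω) ∂μ ≠ ⊤ := hB.neg.lintegral_lt_top.ne
  rw [integral_eq_lintegral_pos_part_sub_lintegral_neg_part hB, EReal.coe_sub,
    EReal.coe_ennreal_toReal hp, EReal.coe_ennreal_toReal hm]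
  refine EReal.sub_le_sub ?_ ?_
  · exact EReal.coe_ennreal_le_coe_ennreal_iff.2
      (lintegral_mono fun ω => EReal.toENNReal_le_toENNReal (h ω))
  · refine EReal.coe_ennreal_le_coe_ennreal_iff.2 (lintegral_mono fun ω => ?_)
    have h1 := EReal.toENNReal_le_toENNReal (EReal.neg_le_neg_iff.2 (h ω))
    rwa [← EReal.coe_neg, EReal.real_coe_toENNReal] at h1

variable {P : Problem n d} {γ : ℝ} {x0 : EuclideanSpace ℝ (Fin d)} {y0 : EuclideanSpace ℝ (Fin n)}

theorem dependsOn_pathPotential (K : ℕ) :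
    DependsOn (fun s => pathPotential P γ x0 y0 s K) (Set.Iio K) := by
  intro s s' h
  simp only [pathPotential]
  rw [pathError_congr h, pathNoise_congr h]

theorem integral_pathPotential_nonpos [IsProbabilityMeasure μ] (hn : 2 ≤ n)
    (hA : ∀ i, P.A i ≠ 0) (hγ : 0 < γ) (hι : ∀ k, Measurable (ι k)) (hind : iIndepFun ι μ)
    (hunif : ∀ k i, μ (ι k ⁻¹' {i}) = (n : ℝ≥0∞)⁻¹) (m : ℕ) :
    ∫ ω, pathPotential P γ x0 y0 (fun k => ι k ω) (m + 1) ∂μ ≤ 0 := by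
  have i0 : Fin n := ⟨0, by omega⟩
  have hn0 : (0 : ℝ) < n := by exact_mod_cast (by omega : 0 < n)
  induction m with
  -- The sums begin at index 1: the first iteration is deterministic and produces no noise.
  | zero => simp [pathPotential, pathError, noisePotential, pathNoise]
  | succ m ih =>
    rw [integral_eq_average i0 hι hind hunif (dependsOn_pathPotential (m + 1 + 1))]
    refine le_trans (integral_mono ?_ (integrable_of_dependsOn i0 hι
      (dependsOn_pathPotential (m + 1))) fun ω => ?_) ih
    · exact (integrable_finsetSum _ fun j _ => integrable_of_dependsOn i0 hι
        (dependsOn_update (dependsOn_pathPotential (m + 1 + 1)) j)).const_mul _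
    · have := sum_pathPotential_update_le (P := P) (x0 := x0) (y0 := y0) (ι := fun k => ι k ω)
        hn hA hγ (by omega : 1 ≤ m + 1)
      exact (inv_mul_le_iff₀ hn0).2 this

theorem expectation_gap_le [IsProbabilityMeasure μ] (hn : 2 ≤ n) (hP : P.Standing)
    (hA : ∀ i, P.A i ≠ 0) (hγ : 0 < γ) (hγ1 : γ < 1)
    {Z : Set (EuclideanSpace ℝ (Fin d) × EuclideanSpace ℝ (Fin n))} (hZc : IsCompact Z)
    (hι : ∀ k, Measurable (ι k)) (hind : iIndepFun ι μ)
    (hunif : ∀ k i, μ (ι k ⁻¹' {i}) = (n : ℝ≥0∞)⁻¹) {K : ℕ} (hK : 2 ≤ K) :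
    expectation μ (fun ω => P.gap Z (xAvg P γ x0 y0 (fun k => ι k ω) K)
      (yAvg P γ x0 y0 (fun k => ι k ω) K)) ≤
    ((n * P.maxRowNorm * DZ x0 y0 Z / (γ * (1 - γ)) / Lam n K : ℝ) : EReal) := by
  have i0 : Fin n := ⟨0, by omega⟩
  have hint := integrable_of_dependsOn (μ := μ) i0 hι
    (dependsOn_pathPotential (P := P) (γ := γ) (x0 := x0) (y0 := y0) K)
  have hΛ := Lam_pos hn (by omega : 1 ≤ K)
  refine (expectation_le_of_le (((integrable_const _).add hint).div_const _) fun ω =>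
    gap_avg_le hn hP hA hγ hγ1 x0 y0 _ hZc hK).trans ?_
  rw [EReal.coe_le_coe_iff, integral_div, integral_add' (integrable_const _) hint]
  obtain ⟨m, rfl⟩ := Nat.exists_eq_add_of_le' (by omega : 1 ≤ K)
  have h := integral_pathPotential_nonpos (P := P) (x0 := x0) (y0 := y0) hn hA hγ hι hind hunif m
  have e : ∫ _, n * P.maxRowNorm / (γ * (1 - γ)) * DZ x0 y0 Z ∂μ =
      n * P.maxRowNorm * DZ x0 y0 Z / (γ * (1 - γ)) := by
    rw [integral_const]; simp; ring
  rw [e]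
  gcongr
  linarith

end Expectation

/-! ### The implementation -/

theorem Counted.bind_value {α β : Type} (c : Counted α) (f : α → Counted β) :
    (c >>= f).value = (f c.value).value := rfl

theorem Counted.bind_ops {α β : Type} (c : Counted α) (f : α → Counted β) :
    (c >>= f).ops = c.ops + (f c.value).ops := rfl

theorem Counted.pure_ops {α : Type} (a : α) : (pure a : Counted α).ops = 0 := rfl

theorem runStep_ops (P : Problem n d) (i : Fin n) (m : Memory n d) :
    (runStep P i m).ops = 15 * d + 20 := by
  simp only [runStep, Counted.bind_ops, Counted.pure_ops, Counted.mul, Counted.vector, Counted.sub,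
    Counted.add, Counted.proxVec, Counted.draw, Counted.sum, Counted.prox₁, Counted.write,
    Counted.div, Counted.min, Finset.sum_const, Finset.card_univ, Fintype.card_fin, smul_eq_mul]
  ring

theorem runInit_ops (P : Problem n d) (γ : ℝ) (x0 : EuclideanSpace ℝ (Fin d))
    (y0 : EuclideanSpace ℝ (Fin n)) :
    (runInit P γ x0 y0).ops = 8 * (n * d) + 10 * n + 6 * d + 5 := by
  simp only [runInit, Counted.bind_ops, Counted.pure_ops, Counted.mul, Counted.vector, Counted.sub,
    Counted.add, Counted.proxVec, Counted.sum, Counted.sqrt, Counted.max,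
    Counted.div, Finset.sum_const, Finset.card_univ, Fintype.card_fin, smul_eq_mul]
  ring

theorem runLoop_ops (P : Problem n d) (γ : ℝ) (x0 : EuclideanSpace ℝ (Fin d))
    (y0 : EuclideanSpace ℝ (Fin n)) (ι : ℕ → Fin n) (j : ℕ) :
    (runLoop P γ x0 y0 ι j).ops = 8 * (n * d) + 10 * n + 6 * d + 5 + j * (15 * d + 20) := by
  induction j with
  | zero => rw [runLoop, runInit_ops]; ring
  | succ j ih => rw [runLoop, Counted.bind_ops, ih, runStep_ops]; ring

theorem run_ops (P : Problem n d) (γ : ℝ) (x0 : EuclideanSpace ℝ (Fin d))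
    (y0 : EuclideanSpace ℝ (Fin n)) (ι : ℕ → Fin n) (K : ℕ) :
    (run P γ x0 y0 ι K).ops =
      8 * (n * d) + 13 * n + 8 * d + 5 + (K - 1) * (15 * d + 20) := by
  simp only [run, Counted.bind_ops, runLoop_ops, Counted.pure_ops, Counted.vector, Counted.div,
    Counted.add, Finset.sum_const, Finset.card_univ, Fintype.card_fin, smul_eq_mul]
  ring

theorem run_ops_le (hn : 1 ≤ n) (hd : 1 ≤ d) (P : Problem n d) (γ : ℝ)
    (x0 : EuclideanSpace ℝ (Fin d)) (y0 : EuclideanSpace ℝ (Fin n)) (ι : ℕ → Fin n) (K : ℕ) :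
    (run P γ x0 y0 ι K).ops ≤ 35 * ((n + K) * d) := by
  rw [run_ops]
  have h1 : (K - 1) * (15 * d + 20) ≤ K * (35 * d) := Nat.mul_le_mul (by omega) (by omega)
  have h2 : n ≤ n * d := Nat.le_mul_of_pos_right n hd
  have h3 : d ≤ n * d := Nat.le_mul_of_pos_left d hn
  have h4 : 35 * ((n + K) * d) = 35 * (n * d) + K * (35 * d) := by ring
  omega

/-- The contents of the memory before iteration `k`. -/
structure Memory.Valid (P : Problem n d) (γ : ℝ) (x0 : EuclideanSpace ℝ (Fin d))
    (y0 : EuclideanSpace ℝ (Fin n)) (ι : ℕ → Fin n) (k : ℕ) (m : Memory n d) : Prop where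
  τ_eq : m.τ = tau P
  σ_eq : ∀ i, m.σ i = sigma P γ i
  x_eq : m.x = (iterates P γ x0 y0 ι k).x
  y_eq : m.y = (iterates P γ x0 y0 ι k).y
  v_eq : m.v = P.mulAT m.y
  sx_eq : m.sx = ∑ j ∈ Finset.range k,
    PureCD.lam n j • (iterates P γ x0 y0 ι (j + 1)).xbar
  lam_eq : m.lam = PureCD.lam n k
  Lam_eq : m.Lam = PureCD.Lam n k
  u_eq : ∀ i, m.Lam * m.y i + m.u i = (iterates P γ x0 y0 ι 1).y i + ∑ j ∈ Finset.Ico 1 k,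
    PureCD.lam n j * (n * (iterates P γ x0 y0 ι (j + 1)).y i
      - (n - 1) * (iterates P γ x0 y0 ι j).y i)

theorem runInit_valid (P : Problem n d) (γ : ℝ) (x0 : EuclideanSpace ℝ (Fin d))
    (y0 : EuclideanSpace ℝ (Fin n)) (ι : ℕ → Fin n) :
    (runInit P γ x0 y0).value.Valid P γ x0 y0 ι 1 := by
  have hnorm : ∀ i, Real.sqrt (∑ j, P.A i j * P.A i j) = P.rowNorm i := by
    intro i
    rw [Problem.rowNorm, EuclideanSpace.norm_eq]
    simp [← sq]
  have hval : (runInit P γ x0 y0).value =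
      let big := ⨆ i, Real.sqrt (∑ j, P.A i j * P.A i j)
      let x1 := prox (1 / (n * big)) P.g (WithLp.toLp 2 fun j =>
        x0 j - 1 / (n * big) * P.mulAT y0 j)
      let y1 := prox (γ / (n * big)) P.hstar (WithLp.toLp 2 fun i =>
        y0 i + γ / (n * big) * P.mulA x1 i)
      ⟨1 / (n * big), WithLp.toLp 2 fun i => γ / Real.sqrt (∑ j, P.A i j * P.A i j), x1, y1,
        P.mulAT y1, x1, WithLp.toLp 2 fun _ => 0, 1 / (n - 1), 1⟩ := rfl
  simp only [hnorm] at hval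
  rw [hval]
  have hx : (iterates P γ x0 y0 ι 1).x = (iterates P γ x0 y0 ι 1).xbar := rfl
  refine ⟨rfl, fun i => rfl, rfl, rfl, rfl, ?_, rfl, (Lam_one n).symm, fun i => ?_⟩
  · simp only [Finset.range_one, Finset.sum_singleton, lam, one_smul]
    rfl
  · simp only [Finset.Ico_self, Finset.sum_empty, add_zero, one_mul]
    rfl

theorem runStep_valid (P : Problem n d) (γ : ℝ) (x0 : EuclideanSpace ℝ (Fin d))
    (y0 : EuclideanSpace ℝ (Fin n)) (ι : ℕ → Fin n) (k : ℕ) {m : Memory n d}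
    (hm : m.Valid P γ x0 y0 ι (k + 1)) :
    (runStep P (ι (k + 1)) m).value.Valid P γ x0 y0 ι (k + 2) := by
  set i := ι (k + 1) with hi
  have hval : (runStep P i m).value =
      let xb := prox (m.τ * m.lam) P.g (WithLp.toLp 2 fun j => m.x j - m.τ * m.lam * m.v j)
      let yi := prox (m.lam * m.σ i) (P.h i) (m.y i + m.lam * m.σ i * P.mulA xb i)
      ⟨m.τ, m.σ, WithLp.toLp 2 fun j => xb j - m.τ * m.lam * (n * (yi - m.y i)) * P.A i j,
        WithLp.toLp 2 (Function.update m.y.ofLp i yi),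
        WithLp.toLp 2 fun j => m.v j + (yi - m.y i) * P.A i j,
        WithLp.toLp 2 fun j => m.sx j + m.lam * xb j,
        WithLp.toLp 2 (Function.update m.u.ofLp i
          (m.u i + (n * m.lam - (m.Lam + m.lam)) * (yi - m.y i))),
        min 1 (n / (n - 1) * m.lam), m.Lam + m.lam⟩ := rfl
  set s := iterates P γ x0 y0 ι (k + 1) with hs
  set l := lam n (k + 1) with hl
  have hxb : prox (m.τ * m.lam) P.g (WithLp.toLp 2 fun j => m.x j - m.τ * m.lam * m.v j) =
      primalProx P l s := by
    rw [hm.τ_eq, hm.lam_eq, hm.v_eq, hm.x_eq, hm.y_eq]; rfl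
  have hyi : prox (m.lam * m.σ i) (P.h i)
      (m.y i + m.lam * m.σ i * P.mulA (primalProx P l s) i) = dualProx P γ l s i := by
    rw [hm.lam_eq, hm.σ_eq, hm.y_eq]; rfl
  simp only [hxb, hyi] at hval
  rw [hval]
  have hit : iterates P γ x0 y0 ι (k + 2) = weightedStep P γ l i s := rfl
  -- For an untouched coordinate, increasing `Lam` by `lam` already adds `lam * y j`, which is the
  -- required increment, so `u` changes only at `i`.
  have hu : ∀ j, (m.Lam + m.lam) * Function.update m.y.ofLp i (dualProx P γ l s i) j
      + Function.update m.u.ofLp i (m.u i + (n * m.lam - (m.Lam + m.lam)) *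
        (dualProx P γ l s i - m.y i)) j = m.Lam * m.y j + m.u j
      + m.lam * (n * Function.update m.y.ofLp i (dualProx P γ l s i) j - (n - 1) * m.y j) := by
    intro j
    by_cases hj : j = i
    · subst hj; simp only [Function.update_self]; ring
    · simp only [Function.update_of_ne hj]; ring
  refine ⟨hm.τ_eq, hm.σ_eq, ?_, ?_, ?_, ?_, ?_, ?_, fun j => ?_⟩
  · rw [hit, weightedStep_x, hm.τ_eq, hm.lam_eq, hm.y_eq]
    rfl
  · rw [hit, weightedStep_y, hm.y_eq]
  · have e : (WithLp.toLp 2 (Function.update m.y.ofLp i (dualProx P γ l s i)) :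
        EuclideanSpace ℝ (Fin n)) = m.y + EuclideanSpace.single i (dualProx P γ l s i - m.y i) := by
      ext j
      by_cases hj : j = i
      · subst hj; simp
      · simp [hj]
    simp only
    rw [e, P.mulAT_add, P.mulAT_single, ← hm.v_eq]
    rfl
  · rw [Finset.sum_range_succ, ← hm.sx_eq, hit, weightedStep_xbar]
    simp only [hm.lam_eq]
    rfl
  · simp only [hm.lam_eq]
    rfl
  · rw [Lam_succ, hm.Lam_eq, hm.lam_eq]
  · rw [Finset.sum_Ico_succ_top (by omega), ← add_assoc, ← hm.u_eq j, hit, weightedStep_y]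
    refine (hu j).trans ?_
    rw [hm.lam_eq, hm.y_eq]

theorem runLoop_valid (P : Problem n d) (γ : ℝ) (x0 : EuclideanSpace ℝ (Fin d))
    (y0 : EuclideanSpace ℝ (Fin n)) (ι : ℕ → Fin n) (k : ℕ) :
    (runLoop P γ x0 y0 ι k).value.Valid P γ x0 y0 ι (k + 1) := by
  induction k with
  | zero =>
    rw [runLoop]
    exact runInit_valid P γ x0 y0 ι
  | succ k ih =>
    rw [runLoop, Counted.bind_value]
    exact runStep_valid P γ x0 y0 ι k ih

theorem run_value (hn : 2 ≤ n) (P : Problem n d) (γ : ℝ) (x0 : EuclideanSpace ℝ (Fin d))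
    (y0 : EuclideanSpace ℝ (Fin n)) (ι : ℕ → Fin n) {K : ℕ} (hK : 2 ≤ K) :
    (run P γ x0 y0 ι K).value = (xAvg P γ x0 y0 ι K, yAvg P γ x0 y0 ι K) := by
  obtain ⟨k, rfl⟩ := Nat.exists_eq_add_of_le' hK
  have hm := runLoop_valid P γ x0 y0 ι (k + 1)
  set m := (runLoop P γ x0 y0 ι (k + 1)).value
  have hval : (run P γ x0 y0 ι (k + 2)).value =
      (WithLp.toLp 2 fun j => m.sx j / m.Lam, WithLp.toLp 2 fun i => m.y i + m.u i / m.Lam) := rfl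
  have hΛ : m.Lam ≠ 0 := by
    rw [hm.Lam_eq]; exact (Lam_pos hn (by omega)).ne'
  rw [hval]
  congr 1
  · rw [xAvg, ← hm.sx_eq, ← hm.Lam_eq]
    ext j
    simp [div_eq_inv_mul]
  · ext i
    have h := hm.u_eq i
    have h2 := dual_summation_by_parts hn (fun k => (iterates P γ x0 y0 ι k).y i) k
    simp only [yAvg, PiLp.smul_apply, PiLp.add_apply, smul_eq_mul, WithLp.ofLp_sum,
      Finset.sum_apply, WithLp.ofLp_smul, Pi.smul_apply]
    have h3 : m.y i + m.u i / m.Lam = 1 / m.Lam * (m.Lam * m.y i + m.u i) := by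
      field_simp
    rw [h3, h]
    have e : k + 2 - 1 = k + 1 := rfl
    rw [h2, e, hm.Lam_eq]

end PureCD

end

/-! ### Rates and complexity -/

theorem mainTheorem2 (γ : ℝ) (hγ0 : 0 < γ) (hγ1 : γ < 1) :
    ∃ C : ℝ, 0 < C ∧
    ∀ (n d : ℕ) (P : PureCD.Problem n d)
      (x0 : EuclideanSpace ℝ (Fin d)) (y0 : EuclideanSpace ℝ (Fin n))
      (Z : Set (EuclideanSpace ℝ (Fin d) × EuclideanSpace ℝ (Fin n)))
      (Ω : Type*) (mΩ : MeasurableSpace Ω) (μ : Measure Ω) (ι : ℕ → Ω → Fin n),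
      2 ≤ n → P.Standing → (∀ i, P.A i ≠ 0) →
      P.g x0 ≠ ⊤ → P.hstar y0 ≠ ⊤ →
      Z.Nonempty → IsCompact Z →
      IsProbabilityMeasure μ → (∀ k, Measurable (ι k)) → iIndepFun ι μ →
      (∀ k i, μ (ι k ⁻¹' {i}) = (n : ℝ≥0∞)⁻¹) →
      let gapK : ℕ → Ω → EReal := fun K ω =>
        P.gap Z (PureCD.xAvg P γ x0 y0 (fun k => ι k ω) K)
          (PureCD.yAvg P γ x0 y0 (fun k => ι k ω) K)
      let D : ℝ := PureCD.DZ x0 y0 Z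
      let M : ℝ := P.maxRowNorm
      -- the gap is an attained maximum, and its expectation is well defined
      (∀ K, 2 ≤ K →
        (∀ ω, gapK K ω ≠ ⊤ ∧
          ∃ z ∈ Z, gapK K ω = P.G (PureCD.xAvg P γ x0 y0 (fun k => ι k ω) K)
            (PureCD.yAvg P γ x0 y0 (fun k => ι k ω) K) z) ∧
        Measurable (gapK K) ∧ ∫⁻ ω, (gapK K ω).toENNReal ∂μ ≠ ⊤) ∧
      -- the two rates
      (∀ (K₀ : ℝ) (K : ℕ), 2 ≤ K →
        ((n : ℝ) - 1) * Real.log ((n : ℝ) - 1) ≤ K₀ →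
        K₀ ≤ 1 + (n : ℝ) * Real.log ((n : ℝ) - 1) →
        ((K : ℝ) ≤ K₀ → PureCD.expectation μ (gapK K) ≤
          ((((1 + 1 / ((n : ℝ) - 1)) ^ K)⁻¹ * (6 * n * M * D / (γ * (1 - γ))) : ℝ) : EReal)) ∧
        (K₀ < (K : ℝ) → PureCD.expectation μ (gapK K) ≤
          ((6 * n * M * D / (((K : ℝ) - K₀ - 1 + ((n : ℝ) - 1) ^ 2 / n) * (γ * (1 - γ))) : ℝ) :
            EReal))) ∧
      -- the implementation computes the averages
      (∀ K, 2 ≤ K → ∀ ω, (PureCD.run P γ x0 y0 (fun k => ι k ω) K).value =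
        (PureCD.xAvg P γ x0 y0 (fun k => ι k ω) K, PureCD.yAvg P γ x0 y0 (fun k => ι k ω) K)) ∧
      -- iteration and operation complexity
      (∀ ε : ℝ, 0 < ε →
        let R : ℝ := n + n * min (Real.log n) (Real.log (1 + n * M * D / ε)) + n * M * D / ε
        ∃ K₁ : ℕ, 2 ≤ K₁ ∧ (K₁ : ℝ) ≤ C * R ∧
          (∀ K, K₁ ≤ K → PureCD.expectation μ (gapK K) ≤ ((ε : ℝ) : EReal)) ∧
          ∀ ω, ((PureCD.run P γ x0 y0 (fun k => ι k ω) K₁).ops : ℝ) ≤ C * (R * d) ∧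
            ((PureCD.run P γ x0 y0 (fun k => ι k ω) K₁).ops : ℝ) ≤
              C * ((1 + Real.log n) * (n * d + n * d * M * D / ε))) := by
  have hc : 1 ≤ 1 / (γ * (1 - γ)) := by
    have h1γ : 0 < 1 - γ := by linarith
    rw [le_div_iff₀ (by positivity)]
    nlinarith
  set c : ℝ := 1 / (γ * (1 - γ)) with hcdef
  -- The iteration count satisfies `K₁ ≤ (c+3) R`, the start adds `n ≤ R`, and 35 is the constant in
  -- `run_ops_le`.
  refine ⟨35 * (c + 4), by linarith, ?_⟩
  intro n d P x0 y0 Z Ω mΩ μ ι hn hP hA _ _ hZ hZc hμ hι hind hunif gapK D M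
  have i0 : Fin n := ⟨0, by omega⟩
  have hN := PureCD.natCast_sub_one_ge_one hn
  have hn0 : (0 : ℝ) < n := by linarith
  have hM : 0 < M := P.maxRowNorm_pos hn hA
  have hD : 0 ≤ D := PureCD.DZ_nonneg x0 y0 hZ hZc
  have h1γ : 0 < 1 - γ := by linarith
  have hγγ : 0 < γ * (1 - γ) := by positivity
  -- Without columns every row would be zero; the operation bound needs `d ≥ 1` to absorb the costs
  -- independent of `d`.
  have hd : 1 ≤ d := by
    by_contra h
    obtain rfl : d = 0 := by omega
    exact hA i0 (Subsingleton.elim _ _)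
  have hgap : ∀ K, 2 ≤ K → PureCD.expectation μ (gapK K) ≤
      ((n * M * D / (γ * (1 - γ)) / PureCD.Lam n K : ℝ) : EReal) := fun K hK =>
    PureCD.expectation_gap_le hn hP hA hγ0 hγ1 hZc hι hind hunif hK
  have hB : 0 ≤ n * M * D / (γ * (1 - γ)) := by positivity
  refine ⟨fun K hK => ⟨fun ω => ?_, ?_, ?_⟩, fun K₀ K hK hK₀ hK₀' => ⟨fun hle => ?_, fun hlt => ?_⟩,
    fun K hK ω => PureCD.run_value hn P γ x0 y0 _ hK, fun ε hε => ?_⟩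
  · exact PureCD.gap_attained hP (PureCD.xAvg_mem_dom hn hP hA hγ0 x0 y0 _ (by omega))
      (PureCD.yAvg_mem_dom hn hP hA hγ0 x0 y0 _ hK) hZ hZc
  · refine PureCD.measurable_of_dependsOn i0 hι (K := K)
      (f := fun s => P.gap Z (PureCD.xAvg P γ x0 y0 s K) (PureCD.yAvg P γ x0 y0 s K)) ?_
    intro s s' h
    simp only
    rw [PureCD.xAvg_congr h, PureCD.yAvg_congr h]
  · have hint := (((integrable_const (n * M / (γ * (1 - γ)) * D)).add
      (PureCD.integrable_of_dependsOn (μ := μ) i0 hι (PureCD.dependsOn_pathPotential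
        (P := P) (γ := γ) (x0 := x0) (y0 := y0) K))).div_const (PureCD.Lam n K))
    refine ne_top_of_le_ne_top hint.lintegral_lt_top.ne (lintegral_mono fun ω => ?_)
    have h := EReal.toENNReal_le_toENNReal
      (PureCD.gap_avg_le hn hP hA hγ0 hγ1 x0 y0 (fun k => ι k ω) hZc hK)
    rwa [EReal.real_coe_toENNReal] at h
  · refine (hgap K hK).trans (EReal.coe_le_coe_iff.2 ?_)
    have h := PureCD.ratio_pow_le_Lam hn (by omega : 1 ≤ K) (hle.trans hK₀')
    have hΛ := PureCD.Lam_pos hn (by omega : 1 ≤ K)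
    have hq := PureCD.one_lt_ratio hn
    rw [← PureCD.ratio_eq hn]
    set q : ℝ := ((n : ℝ) / ((n : ℝ) - 1)) ^ K with hqdef
    have hq0 : 0 < q := by positivity
    rw [inv_mul_eq_div, div_le_div_iff₀ hΛ hq0]
    calc n * M * D / (γ * (1 - γ)) * q ≤ n * M * D / (γ * (1 - γ)) * (6 * PureCD.Lam n K) := by
          gcongr
      _ = _ := by ring
  · refine (hgap K hK).trans (EReal.coe_le_coe_iff.2 ?_)
    have h := PureCD.linear_le_Lam hn (by omega : 1 ≤ K) hK₀ hlt
    have hΛ := PureCD.Lam_pos hn (by omega : 1 ≤ K)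
    have hq0 := PureCD.linear_denominator_pos hn hK hK₀' hlt
    set q : ℝ := (K : ℝ) - K₀ - 1 + ((n : ℝ) - 1) ^ 2 / n with hqdef
    rw [div_le_div_iff₀ hΛ (by positivity)]
    calc n * M * D / (γ * (1 - γ)) * (q * (γ * (1 - γ)))
        ≤ n * M * D / (γ * (1 - γ)) * ((6 * PureCD.Lam n K) * (γ * (1 - γ))) := by gcongr
      _ = _ := by field_simp
  · intro R
    set r : ℝ := n * M * D / ε with hr
    have hr0 : 0 ≤ r := by positivity
    set l : ℝ := min (Real.log n) (Real.log (1 + r)) with hl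
    have hl0 : 0 ≤ l := le_min (Real.log_nonneg (by linarith)) (Real.log_nonneg (by linarith))
    have hR : R = n + n * l + r := rfl
    have hx0 : 0 ≤ n * (c * l) + c * r := by positivity
    -- The threshold of `mul_le_Lam`, beyond which `Λ_K ≥ c r`, that is, the gap bound is at most
    -- `ε`.
    set K₁ := ⌈2 + n * (c * l) + c * r⌉₊ with hK₁
    have hK₁ge : 2 + n * (c * l) + c * r ≤ K₁ := Nat.le_ceil _
    have hK₁lt : (K₁ : ℝ) < 2 + n * (c * l) + c * r + 1 := Nat.ceil_lt_add_one (by linarith)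
    have hK₁2 : 2 ≤ K₁ := by
      have : (2 : ℝ) ≤ K₁ := by linarith
      exact_mod_cast this
    have hnl : 0 ≤ n * l := by positivity
    have hK₁R : (K₁ : ℝ) ≤ (c + 3) * R := by
      rw [hR]
      nlinarith
    have hnR : (n : ℝ) ≤ R := by rw [hR]; linarith
    have hd0 : (0 : ℝ) < d := by exact_mod_cast hd
    have hops : ∀ ω, ((PureCD.run P γ x0 y0 (fun k => ι k ω) K₁).ops : ℝ) ≤
        35 * (c + 4) * (R * d) := by
      intro ω
      have h : ((PureCD.run P γ x0 y0 (fun k => ι k ω) K₁).ops : ℝ) ≤ 35 * ((n + K₁) * d) := by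
        exact_mod_cast PureCD.run_ops_le (by omega) hd P γ x0 y0 (fun k => ι k ω) K₁
      refine h.trans ?_
      have : (n : ℝ) + K₁ ≤ (c + 4) * R := by linarith
      calc (35 : ℝ) * ((n + K₁) * d) ≤ 35 * ((c + 4) * R * d) := by gcongr
        _ = _ := by ring
    refine ⟨K₁, hK₁2, ?_, fun K hK => ?_, fun ω => ⟨hops ω, (hops ω).trans ?_⟩⟩
    · refine hK₁R.trans ?_
      gcongr
      linarith
    · have hK2 : 2 ≤ K := hK₁2.trans hK
      refine (hgap K hK2).trans (EReal.coe_le_coe_iff.2 ?_)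
      have hΛ := PureCD.mul_le_Lam hn hc hr0 (K := K)
        (hK₁ge.trans (by exact_mod_cast hK))
      rw [div_le_iff₀ (PureCD.Lam_pos hn (by omega))]
      calc n * M * D / (γ * (1 - γ)) = ε * (c * r) := by rw [hcdef, hr]; field_simp
        _ ≤ _ := by gcongr
    · have hlog : 0 ≤ Real.log n := Real.log_nonneg (by linarith)
      have h1 : R ≤ (1 + Real.log n) * (n + r) := by
        rw [hR]
        have : n * l ≤ n * Real.log n := by gcongr; exact min_le_left _ _
        nlinarith
      have e : (1 + Real.log n) * (n * d + n * d * M * D / ε) =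
          (1 + Real.log n) * (n + r) * d := by
        rw [hr]; ring
      rw [e]
      gcongr
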